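/- Let $1<\alpha\le 2$, $q=\alpha/2$, $T>0$, $J=[0,T]$, and let $X$ be a Banach space. Let $\psi\in C^1(J;\mathbb R)$ be strictly increasing with $\psi'(0)\neq 0$. Let $A$ be the infinitesimal generator of a strongly continuous cosine family $(C(t))_{t\in\mathbb R}$ of bounded linear operators on $X$ with $\|C(t)\|_{L(X)}\le\mathcal K$ for all $t\in\mathbb R$, where $\mathcal K\ge 1$ is a constant, and put $S(t)x=\int_0^tC(s)x\,ds$. Let $\Theta_0,\Theta_1\in X$ and $f:J\times X\to X$. Consider the problem with the $\psi$-Caputo derivative $$ {}^{C}\!D^{\alpha,\psi}_{0^+}\Theta(t)=A\Theta(t)+f(t,\Theta(t)),\ t\in J,\qquad \Theta(0)=\Theta_0,\quad \Theta'(0)=\Theta_1. \tag{1}$$ For $0<q<1$ let $M_q(z)=\sum_{n\ge0}\frac{(-z)^n}{n!\,\Gamma(1-q(n+1))}$ (with $1/\Gamma=0$ at the poles of $\Gamma$), and in the limit case $q=1$ read $M_1(\theta)\,d\theta$ as the Dirac mass at $\theta=1$. For $x\in X$ and $0\le s\le t\le T$ put $$C_q^\psi(t,0)x=\int_0^\infty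 M_q(\theta)\,C\big((\psi(t)-\psi(0))^q\theta\big)x\,d\theta,\qquad R_q^\psi(t,0)x=\int_0^t C_q^\psi(s,0)x\,\frac{\psi'(s)}{\psi'(0)}\,ds,$$ $$P_q^\psi(t,s)x=\int_0^\infty q\,\theta\, M_q(\theta)\,S\big((\psi(t)-\psi(s))^q\theta\big)x\,d\theta .$$ A mild solution of (1) is a function $\Theta\in C(J;X)$ such that $\Theta=\Psi\Theta$ on $J$, where $$(\Psi\Theta)(t)=C_q^\psi(t,0)\Theta_0+R_q^\psi(t,0)\Theta_1+\int_0^t(\psi(t)-\psi(s))^{q-1}P_q^\psi(t,s)f(s,\Theta(s))\,\psi'(s)\,ds,\qquad t\in J .$$ **Theorem 4.1.** Assume: (H1) $f$ is continuous and there is a constant $N_0>0$ with $\|f(t,x)-f(t,y)\|_X\le N_0\|x-y\|_X$ for all $t\in J$ and $x,y\in X$; (H2) $L:=\dfrac{\mathcal K N_0(\psi(T)-\psi(0))^{2q}}{\Gamma(2q+1)}<1$. Then all integrals above converge (for all $x\in X$ and all $\Theta\in C(J;X)$), $\Psi$ maps $C(J;X)$ (with the sup norm) into itself and is a contraction with constant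 $L$, and (1) has a unique mild solution in $C(J;X)$, namely the fixed point of $\Psi$. -/

import Mathlib

open Set MeasureTheory

noncomputable section

namespace FracCosine

/-- Mainardi's Wright-type function
`M_q(z) = ∑_{n ≥ 0} (-z)^n / (n! Γ(1 - q(n+1)))`, for `0 < q < 1`.
At a pole of `Γ` the reciprocal `1 / Γ` is `0`, as usual; this is also what `Real.Gamma` and
division in `ℝ` give, because `Real.Gamma` is `0` at its poles. -/
def mainardi (q z : ℝ) : ℝ :=
  ∑' n : ℕ, (-z) ^ n / ((n.factorial : ℝ) * Real.Gamma (1 - q * ((n : ℝ) + 1)))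

variable {X : Type*} [NormedAddCommGroup X] [NormedSpace ℝ X]

/-- The integral `∫_0^∞ M_q(θ) g(θ) dθ` for `q < 1`. In the limit case `q = 1` the probability
`M_q(θ) dθ` is the Dirac mass at `θ = 1` (its moments are `Γ(1+n)/Γ(1+n) = 1`), so that the
integral is `g 1`. -/
def mainardiIntegral (q : ℝ) (g : ℝ → X) : X :=
  if q = 1 then g 1 else ∫ θ in Ioi (0 : ℝ), mainardi q θ • g θ

/-- Convergence (as a Bochner integral) of the integral in `mainardiIntegral`. In the case `q = 1`
nothing is required. -/
def MainardiIntegrable (q : ℝ) (g : ℝ → X) : Prop :=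
  q ≠ 1 → IntegrableOn (fun θ : ℝ => mainardi q θ • g θ) (Ioi (0 : ℝ))

/-- Strongly continuous cosine families of bounded linear operators on `X`. -/
structure IsCosineFamily (C : ℝ → X →L[ℝ] X) : Prop where
  map_zero : C 0 = ContinuousLinearMap.id ℝ X
  add_sub : ∀ s t : ℝ, C (t + s) + C (t - s) = (2 : ℝ) • (C t).comp (C s)
  strong_continuous : ∀ x : X, Continuous fun t : ℝ => C t x

/-- `A` is the infinitesimal generator of the cosine family `C`: its domain consists of
all `x` for which `t ↦ C(t)x` is of class `C²`, and `A x` is the second derivative of `C(t)x` at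
`t = 0`. -/
structure IsCosineGenerator (C : ℝ → X →L[ℝ] X) (A : X →ₗ.[ℝ] X) : Prop where
  mem_domain_iff : ∀ x : X, x ∈ A.domain ↔ ContDiff ℝ 2 fun t : ℝ => C t x
  apply_eq : ∀ x : A.domain, A x = iteratedDeriv 2 (fun t : ℝ => C t (x : X)) 0

/-- The associated sine family `S(t)x = ∫_0^t C(s)x ds`. -/
def sine (C : ℝ → X →L[ℝ] X) (t : ℝ) (x : X) : X :=
  ∫ s in (0 : ℝ)..t, C s x

/-- The derivative of `ψ` on `J = [0,T]` (one-sided at the end points). -/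
def dpsi (T : ℝ) (ψ : ℝ → ℝ) (s : ℝ) : ℝ :=
  derivWithin ψ (Icc 0 T) s

/-- `C_q^ψ(t,0) x = ∫_0^∞ M_q(θ) C((ψ(t)-ψ(0))^q θ) x dθ`. -/
def opC (q : ℝ) (C : ℝ → X →L[ℝ] X) (ψ : ℝ → ℝ) (t : ℝ) (x : X) : X :=
  mainardiIntegral q fun θ => C ((ψ t - ψ 0) ^ q * θ) x

/-- `R_q^ψ(t,0) x = ∫_0^t C_q^ψ(s,0) (ψ'(s)/ψ'(0)) x ds`. -/
def opR (q : ℝ) (C : ℝ → X →L[ℝ] X) (T : ℝ) (ψ : ℝ → ℝ) (t : ℝ) (x : X) : X :=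
  ∫ s in (0 : ℝ)..t, (dpsi T ψ s / dpsi T ψ 0) • opC q C ψ s x

/-- `P_q^ψ(t,s) x = ∫_0^∞ q θ M_q(θ) S((ψ(t)-ψ(s))^q θ) x dθ`. -/
def opP (q : ℝ) (C : ℝ → X →L[ℝ] X) (ψ : ℝ → ℝ) (t s : ℝ) (x : X) : X :=
  mainardiIntegral q fun θ => (q * θ) • sine C ((ψ t - ψ s) ^ q * θ) x

/-- The integrand `s ↦ (ψ(t)-ψ(s))^{q-1} P_q^ψ(t,s) f(s,Θ(s)) ψ'(s)`. -/
def duhamelIntegrand (q : ℝ) (C : ℝ → X →L[ℝ] X) (T : ℝ) (ψ : ℝ → ℝ) (f : ℝ → X → X)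
    (Θ : ℝ → X) (t s : ℝ) : X :=
  ((ψ t - ψ s) ^ (q - 1) * dpsi T ψ s) • opP q C ψ t s (f s (Θ s))

/-- The right-hand side of the mild-solution formula. -/
def mildRHS (q : ℝ) (C : ℝ → X →L[ℝ] X) (T : ℝ) (ψ : ℝ → ℝ) (f : ℝ → X → X)
    (Θ₀ Θ₁ : X) (Θ : ℝ → X) (t : ℝ) : X :=
  opC q C ψ t Θ₀ + opR q C T ψ t Θ₁ + ∫ s in (0 : ℝ)..t, duhamelIntegrand q C T ψ f Θ t s

/-- `Θ ∈ C(J;X)`, `J = [0,T]`, is a mild solution of order `α = 2q` of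
`D^{α,ψ} Θ = A Θ + f(t,Θ)`, `Θ(0) = Θ₀`, `Θ'(0) = Θ₁`, where `A` generates `C`. Only values of
`Θ` at points of `J` enter, so the way in which `Θ` is extended to `ℝ` is irrelevant. -/
def IsMildSolution (q : ℝ) (C : ℝ → X →L[ℝ] X) {T : ℝ} (hT : 0 < T) (ψ : ℝ → ℝ)
    (f : ℝ → X → X) (Θ₀ Θ₁ : X) (Θ : C(Icc (0 : ℝ) T, X)) : Prop :=
  ∀ t : Icc (0 : ℝ) T,
    Θ t = mildRHS q C T ψ f Θ₀ Θ₁ (IccExtend hT.le Θ) (t : ℝ)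

/-- All integrals in the mild-solution formula converge, for all vectors `x` and all
`Θ ∈ C(J;X)`. -/
structure FormulaWellDefined (q : ℝ) (C : ℝ → X →L[ℝ] X) {T : ℝ} (hT : 0 < T) (ψ : ℝ → ℝ)
    (f : ℝ → X → X) : Prop where
  opC_integrable : ∀ x : X, ∀ t ∈ Icc 0 T,
    MainardiIntegrable q fun θ => C ((ψ t - ψ 0) ^ q * θ) x
  opR_integrable : ∀ x : X, ∀ t ∈ Icc 0 T,
    IntervalIntegrable (fun s => (dpsi T ψ s / dpsi T ψ 0) • opC q C ψ s x) volume 0 t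
  opP_integrable : ∀ x : X, ∀ t ∈ Icc 0 T, ∀ s ∈ Icc 0 t,
    MainardiIntegrable q fun θ => (q * θ) • sine C ((ψ t - ψ s) ^ q * θ) x
  duhamel_integrable : ∀ Θ : C(Icc (0 : ℝ) T, X), ∀ t ∈ Icc 0 T,
    IntervalIntegrable (duhamelIntegrand q C T ψ f (IccExtend hT.le Θ) t) volume 0 t

end FracCosine

end

/-!
The map `Ψ` is a contraction because its Duhamel kernel satisfies
`‖(ψ(t)-ψ(s))^{q-1} P_q^ψ(t,s)‖ ≤ K (ψ(t)-ψ(s))^{2q-1} / Γ(2q)`, and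
`∫_0^t (ψ(t)-ψ(s))^{2q-1} ψ'(s) ds = (ψ(t)-ψ(0))^{2q} / (2q)`
(`FormulaData.norm_integral_memoryKernel_le`). Since `‖S(τ)‖ ≤ K |τ|`, this bound on the kernel
amounts to `∫ θ² |M_q(θ)| dθ = 2 / Γ(2q+1)`. Everything else is dominated convergence and Banach's
fixed point theorem. For `q = 1` the measure `M_q(θ) dθ` is a Dirac mass and there is nothing to
show; for `1/2 < q < 1` the second moment and the nonnegativity of `M_q`, known only through a power
series with coefficients of both signs, are the substance of the proof.

Both come from the function `g(t) = q t^{-q-1} M_q(t^{-q})`, the one-sided `q`-stable density.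
Expanding `e^{-z^q}` shows that `g(t)` is `1/π` times the imaginary part of `∫ e^{tz - z^q} dz` over
a ray `arg z = β` on which `e^{tz}` and `e^{-z^q}` both decay (`stableDensity_eq_mainardi`). By
Fubini and Cauchy's theorem its Laplace transform is `e^{-s^q}` (`integral_stableDensity_laplace`).
This function is completely monotone, so that all integrals `∫ tⁿ e^{-st} g(t) dt` are nonnegative
(`integral_pow_mul_exp_nonneg_of_laplace`), and letting the weight `tⁿ e^{-nt/t₀}` concentrate at
`t₀` gives `g ≥ 0` (`nonneg_of_integral_pow_mul_exp_nonneg`). Integrating the Laplace transform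
against `s^{2q-1}` yields the moment of order `-2q` of `g`, which is the second moment of `M_q`
(`mainardi_second_moment`).
-/

noncomputable section

namespace FracCosine

open Filter Topology

/-! ### The power series of the Mainardi function -/

/-- Log-convexity of `Γ` between `x` and `x + 1`. -/
lemma Gamma_add_le {x q : ℝ} (hx : 0 < x) (hq : 0 < q) (hq1 : q < 1) :
    Real.Gamma (x + q) ≤ x ^ q * Real.Gamma x := by
  have h := Real.Gamma_mul_add_mul_le_rpow_Gamma_mul_rpow_Gamma (s := x) (t := x + 1)
    (a := 1 - q) (b := q) hx (by linarith) (by linarith) hq (by ring)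
  have hG := Real.Gamma_pos_of_pos hx
  rw [Real.Gamma_add_one hx.ne', Real.mul_rpow hx.le hG.le] at h
  calc Real.Gamma (x + q) = Real.Gamma ((1 - q) * x + q * (x + 1)) := by ring_nf
    _ ≤ _ := h
    _ = x ^ q * (Real.Gamma x ^ (1 - q) * Real.Gamma x ^ q) := by ring
    _ = x ^ q * Real.Gamma x := by
        rw [← Real.rpow_add hG]; simp

lemma summable_Gamma_mul_pow {q b R : ℝ} (hq : 0 < q) (hq1 : q < 1) (hb : 0 < b) (hR : 0 ≤ R) :
    Summable fun n : ℕ => Real.Gamma (q * n + b) * R ^ n / n.factorial := by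
  have hlim : Filter.Tendsto (fun n : ℕ => (q + b) ^ q * R * ((n : ℝ) + 1) ^ (-(1 - q)))
      Filter.atTop (nhds 0) := by
    have h1 : Filter.Tendsto (fun n : ℕ => ((n : ℝ) + 1)) Filter.atTop Filter.atTop :=
      Filter.tendsto_atTop_add_const_right _ _ tendsto_natCast_atTop_atTop
    have h2 := (tendsto_rpow_neg_atTop (y := 1 - q) (by linarith)).comp h1
    simpa using h2.const_mul ((q + b) ^ q * R)
  have hev := hlim.eventually (ge_mem_nhds (show (0 : ℝ) < 1 / 2 by norm_num))
  refine summable_of_ratio_norm_eventually_le (r := 1 / 2) (by norm_num) ?_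
  filter_upwards [hev] with n hn
  have hx : 0 < q * n + b := by positivity
  have hG := Real.Gamma_pos_of_pos hx
  have hG' : 0 < Real.Gamma (q * (n + 1 : ℕ) + b) := Real.Gamma_pos_of_pos (by positivity)
  rw [Real.norm_of_nonneg (by positivity), Real.norm_of_nonneg (by positivity)]
  have h1 : Real.Gamma (q * (n + 1 : ℕ) + b) ≤
      ((q + b) * (n + 1)) ^ q * Real.Gamma (q * n + b) := by
    have := Gamma_add_le hx hq hq1
    calc Real.Gamma (q * (n + 1 : ℕ) + b) = Real.Gamma (q * n + b + q) := by
          push_cast; ring_nf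
      _ ≤ _ := this
      _ ≤ _ := by
        gcongr
        nlinarith [mul_nonneg hb.le (Nat.cast_nonneg (α := ℝ) n)]
  have hn1 : (0 : ℝ) < n + 1 := by positivity
  rw [Real.mul_rpow (by positivity) (by positivity)] at h1
  have h2 : ((n : ℝ) + 1) ^ q = ((n : ℝ) + 1) ^ (-(1 - q)) * (n + 1) := by
    nth_rewrite 3 [← Real.rpow_one ((n : ℝ) + 1)]
    rw [← Real.rpow_add hn1]; ring_nf
  calc Real.Gamma (q * (n + 1 : ℕ) + b) * R ^ (n + 1) / (n + 1).factorial
      ≤ ((q + b) ^ q * (n + 1) ^ q * Real.Gamma (q * n + b)) * R ^ (n + 1) /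
          (n + 1).factorial := by gcongr
    _ = ((q + b) ^ q * R * ((n : ℝ) + 1) ^ (-(1 - q))) *
          (Real.Gamma (q * n + b) * R ^ n / n.factorial) := by
        rw [h2, Nat.factorial_succ, pow_succ]; push_cast; field_simp
    _ ≤ _ := by gcongr

/-- At a pole of `Γ (1 - a)` both sides vanish, the left one by the convention `1 / 0 = 0`. -/
lemma inv_Gamma_one_sub {a : ℝ} (ha : 0 < a) :
    (Real.Gamma (1 - a))⁻¹ = Real.Gamma a * Real.sin (Real.pi * a) / Real.pi := by
  have h := Real.Gamma_mul_Gamma_one_sub a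
  have hG := Real.Gamma_pos_of_pos ha
  rcases eq_or_ne (Real.sin (Real.pi * a)) 0 with h0 | h0
  · have : Real.Gamma (1 - a) = 0 := by
      rw [h0, div_zero] at h
      exact (mul_eq_zero.1 h).resolve_left hG.ne'
    simp [this, h0]
  · have hne : Real.Gamma (1 - a) ≠ 0 := by
      intro h1
      rw [h1, mul_zero] at h
      exact (div_ne_zero Real.pi_ne_zero h0) h.symm
    rw [eq_div_iff h0] at h
    rw [inv_eq_one_div, div_eq_div_iff hne Real.pi_ne_zero]
    linarith

/-- By the reflection formula the coefficients of `M_q` are `Γ(q(n+1)) sin(πq(n+1)) / (π n!)`, whose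
growth is controlled by `summable_Gamma_mul_pow`. -/
lemma mainardi_eq_tsum_Gamma {q : ℝ} (hq : 0 < q) (z : ℝ) :
    mainardi q z = ∑' n : ℕ, (-z) ^ n / n.factorial *
      (Real.Gamma (q * n + q) * Real.sin (Real.pi * (q * n + q)) / Real.pi) := by
  refine tsum_congr fun n => ?_
  rw [← inv_Gamma_one_sub (by positivity), div_mul_eq_div_div, div_eq_mul_inv _ (Real.Gamma _)]
  ring_nf

lemma continuous_mainardi {q : ℝ} (hq : 0 < q) (hq1 : q < 1) : Continuous (mainardi q) := by
  refine continuous_iff_continuousAt.2 fun z₀ => ?_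
  set R := |z₀| + 1
  have hR : 0 ≤ R := by positivity
  have hc : ContinuousOn (mainardi q) (Ioo (-R) R) := by
    rw [show mainardi q = _ from funext (mainardi_eq_tsum_Gamma hq)]
    refine continuousOn_tsum (fun n => by fun_prop)
      (summable_Gamma_mul_pow hq hq1 hq hR) fun n z hz => ?_
    have hz' : |z| ≤ R := abs_le.2 ⟨hz.1.le, hz.2.le⟩
    have hG : 0 < Real.Gamma (q * n + q) := Real.Gamma_pos_of_pos (by positivity)
    rw [norm_mul, norm_div, norm_pow, norm_div, norm_mul, norm_neg, Real.norm_eq_abs,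
      Real.norm_of_nonneg hG.le, Real.norm_of_nonneg Real.pi_pos.le, Real.norm_natCast]
    have hs : ‖Real.sin (Real.pi * (q * n + q))‖ / Real.pi ≤ 1 := by
      rw [div_le_one Real.pi_pos]
      exact (Real.abs_sin_le_one _).trans (by linarith [Real.pi_gt_three])
    calc |z| ^ n / n.factorial *
          (Real.Gamma (q * n + q) * ‖Real.sin (Real.pi * (q * n + q))‖ / Real.pi)
        = (Real.Gamma (q * n + q) * |z| ^ n / n.factorial) *
          (‖Real.sin (Real.pi * (q * n + q))‖ / Real.pi) := by ring
      _ ≤ (Real.Gamma (q * n + q) * R ^ n / n.factorial) * 1 := by gcongr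
      _ = _ := mul_one _
  refine hc.continuousAt (Ioo_mem_nhds ?_ ?_)
  · linarith [neg_abs_le z₀]
  · linarith [le_abs_self z₀]

/-! ### Rotation of rays of integration -/

lemma integral_Ioi_eq_integral_exp (G : ℝ → ℂ) :
    ∫ r in Ioi (0 : ℝ), G r = ∫ x, Real.exp x • G (Real.exp x) := by
  have h := integral_image_eq_integral_abs_deriv_smul (s := univ) (f := Real.exp)
    (f' := Real.exp) MeasurableSet.univ (fun x _ => (Real.hasDerivAt_exp x).hasDerivWithinAt)
    Real.exp_injective.injOn G
  simpa [Real.range_exp] using h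

lemma integrableOn_Ioi_iff_integrable_exp (G : ℝ → ℂ) :
    IntegrableOn G (Ioi 0) ↔ Integrable fun x => Real.exp x • G (Real.exp x) := by
  have h := integrableOn_image_iff_integrableOn_abs_deriv_smul (s := univ) (f := Real.exp)
    (f' := Real.exp) MeasurableSet.univ (fun x _ => (Real.hasDerivAt_exp x).hasDerivWithinAt)
    Real.exp_injective.injOn G
  simpa [Real.range_exp] using h

lemma tendsto_integral_exp_coordinate {G : ℝ → ℂ} (hG : IntegrableOn G (Ioi 0)) :
    Tendsto (fun R : ℝ => ∫ x in (-R)..R, Real.exp x • G (Real.exp x)) atTop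
      (𝓝 (∫ r in Ioi (0 : ℝ), G r)) := by
  rw [integral_Ioi_eq_integral_exp]
  exact intervalIntegral_tendsto_integral ((integrableOn_Ioi_iff_integrable_exp G).1 hG)
    tendsto_neg_atTop_atBot tendsto_id

/-- Rotation of a ray of integration, in the logarithmic coordinate `w = log z`: the integral of
`H` over the real axis equals the one over `Im w = θ`, where `H dw` is `G(r) dr` with
`r = e^{Re w}`. The functions `B` and `B'` bound `H` on the vertical sides of the rectangles. On the
real axis only the limit of symmetric integrals is claimed, so no integrability is needed there. -/
lemma tendsto_integral_rotate {H : ℂ → ℂ} {G : ℝ → ℂ} {B B' : ℝ → ℝ} {θ : ℝ} (hθ : 0 ≤ θ)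
    (hθπ : θ < Real.pi) (hH : DifferentiableOn ℂ H {w | |w.im| < Real.pi})
    (hB : ∀ᶠ x : ℝ in atTop, ∀ y ∈ Icc 0 θ, ‖H (x + y * Complex.I)‖ ≤ B x)
    (hBtop : Tendsto B atTop (𝓝 0))
    (hB' : ∀ᶠ x : ℝ in atBot, ∀ y ∈ Icc 0 θ, ‖H (x + y * Complex.I)‖ ≤ B' x)
    (hBbot : Tendsto B' atBot (𝓝 0))
    (hG : IntegrableOn G (Ioi 0))
    (hHG : ∀ x : ℝ, H (x + θ * Complex.I) = Real.exp x • G (Real.exp x)) :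
    Tendsto (fun R : ℝ => ∫ x in (-R)..R, H x) atTop (𝓝 (∫ r in Ioi (0 : ℝ), G r)) := by
  have hrect : ∀ R : ℝ, ∫ x in (-R)..R, H x =
      (∫ x in (-R)..R, Real.exp x • G (Real.exp x))
        - Complex.I • (∫ y in (0 : ℝ)..θ, H (R + y * Complex.I))
        + Complex.I • (∫ y in (0 : ℝ)..θ, H ((-R : ℝ) + y * Complex.I)) := by
    intro R
    have h := Complex.integral_boundary_rect_eq_zero_of_differentiableOn H ((-R : ℝ) : ℂ)
      (R + θ * Complex.I) (hH.mono ?_)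
    · simp only [Complex.ofReal_re, Complex.add_re, Complex.mul_re, Complex.I_re, mul_zero,
        Complex.ofReal_im, Complex.I_im, mul_one, sub_self, add_zero, Complex.add_im,
        Complex.mul_im, zero_add, Complex.ofReal_zero, zero_mul, hHG] at h
      linear_combination h
    · intro w hw
      have := hw.2
      simp [uIcc_of_le hθ] at this
      simp only [mem_ofPred_eq, abs_lt]
      constructor <;> linarith [this.1, this.2, Real.pi_pos]
  have hvert : ∀ {u b : ℝ → ℝ} {l : Filter ℝ}, Tendsto u atTop l → Tendsto b l (𝓝 0) →
      (∀ᶠ x : ℝ in l, ∀ y ∈ Icc 0 θ, ‖H (x + y * Complex.I)‖ ≤ b x) →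
      Tendsto (fun R => Complex.I • ∫ y in (0 : ℝ)..θ, H (u R + y * Complex.I)) atTop (𝓝 0) := by
    intro u b l hu hl hb
    have h0 : Tendsto (fun R => b (u R) * |θ - 0|) atTop (𝓝 0) := by
      simpa using (hl.comp hu).mul_const |θ - 0|
    refine squeeze_zero_norm' ((hu.eventually hb).mono fun R hR => ?_) h0
    rw [norm_smul, Complex.norm_I, one_mul]
    refine intervalIntegral.norm_integral_le_of_norm_le_const fun y hy => ?_
    rw [uIoc_of_le hθ] at hy
    exact hR _ ⟨hy.1.le, hy.2⟩
  have := ((tendsto_integral_exp_coordinate hG).sub (hvert tendsto_id hBtop hB)).add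
    (hvert tendsto_neg_atTop_atBot hBbot hB')
  simp only [sub_zero, add_zero, id] at this
  exact this.congr fun R => (hrect R).symm

lemma integrableOn_rpow_mul_cexp {a : ℝ} {c : ℂ} (ha : 0 < a) (hc : 0 < c.re) :
    IntegrableOn (fun r : ℝ => ((r ^ (a - 1) : ℝ) : ℂ) * Complex.exp (-(c * r))) (Ioi 0) := by
  have h := integrableOn_rpow_mul_exp_neg_mul_rpow (p := 1) (s := a - 1) (b := c.re)
    (by linarith) one_pos hc
  refine h.mono' ?_ ?_
  · refine ContinuousOn.aestronglyMeasurable (fun r hr => ?_) measurableSet_Ioi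
    have : r ≠ 0 := (mem_Ioi.1 hr).ne'
    refine ContinuousAt.continuousWithinAt ?_
    refine ContinuousAt.mul ?_ (by fun_prop)
    exact Complex.continuous_ofReal.continuousAt.comp (Real.continuousAt_rpow_const _ _ (.inl this))
  · refine (ae_restrict_iff' measurableSet_Ioi).2 (.of_forall fun r hr => ?_)
    have hr : 0 < r := hr
    rw [norm_mul, Complex.norm_real, Real.norm_of_nonneg (by positivity), Complex.norm_exp]
    simp

lemma tendsto_mul_sub_mul_exp_atBot {a c : ℝ} (hc : 0 < c) :
    Tendsto (fun x => a * x - c * Real.exp x) atTop atBot := by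
  have h1 : Tendsto (fun x => Real.exp x / x) atTop atTop := by
    simpa using Real.tendsto_exp_div_pow_atTop 1
  have h2 : Tendsto (fun x => a - c * (Real.exp x / x)) atTop atBot :=
    tendsto_atBot_add_const_left _ a (tendsto_neg_atTop_atBot.comp (h1.const_mul_atTop hc))
  refine (tendsto_id.atTop_mul_atBot₀ h2).congr' ?_
  filter_upwards [eventually_gt_atTop 0] with x hx
  simp only [id]
  field_simp

/-- Euler's integral for the Gamma function along a rotated ray. -/
lemma integral_rpow_mul_cexp_rotate {a θ : ℝ} (ha : 0 < a) (hθ : 0 ≤ θ) (hθ2 : θ < Real.pi / 2) :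
    ∫ r in Ioi (0 : ℝ), ((r ^ (a - 1) : ℝ) : ℂ) *
        Complex.exp (-(Complex.exp (θ * Complex.I) * r)) =
      Complex.exp (-(a * θ * Complex.I)) * Real.Gamma a := by
  have hcos : 0 < Real.cos θ := Real.cos_pos_of_mem_Ioo ⟨by linarith, hθ2⟩
  have hline : ∀ φ x : ℝ, Complex.exp (a * (x + φ * Complex.I) - Complex.exp (x + φ * Complex.I)) =
      Real.exp x • (Complex.exp (a * φ * Complex.I) * (((Real.exp x ^ (a - 1) : ℝ) : ℂ) *
        Complex.exp (-(Complex.exp (φ * Complex.I) * Real.exp x)))) := by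
    intro φ x
    rw [← Real.exp_mul, Complex.real_smul, Complex.ofReal_exp, Complex.ofReal_exp,
      ← Complex.exp_add, ← Complex.exp_add, ← Complex.exp_add, Complex.exp_add (x : ℂ)]
    congr 1
    push_cast
    ring
  have hint : ∀ φ : ℝ, 0 < Real.cos φ → IntegrableOn (fun r : ℝ => Complex.exp (a * φ * Complex.I) *
      (((r ^ (a - 1) : ℝ) : ℂ) * Complex.exp (-(Complex.exp (φ * Complex.I) * r)))) (Ioi 0) := by
    intro φ hφ
    refine (integrableOn_rpow_mul_cexp ha ?_).const_mul _
    rw [Complex.exp_ofReal_mul_I_re]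
    exact hφ
  have hB : ∀ x : ℝ, ∀ y ∈ Icc 0 θ, ‖Complex.exp (a * (x + y * Complex.I) -
      Complex.exp (x + y * Complex.I))‖ ≤ Real.exp (a * x - Real.cos θ * Real.exp x) := by
    intro x y hy
    rw [Complex.norm_exp]
    refine Real.exp_le_exp.2 ?_
    have hcy : Real.cos θ ≤ Real.cos y :=
      Real.cos_le_cos_of_nonneg_of_le_pi hy.1 (by linarith) hy.2
    have : (Complex.exp (x + y * Complex.I)).re = Real.exp x * Real.cos y := by
      simp [Complex.exp_re]
    rw [Complex.sub_re, this]
    have := mul_le_mul_of_nonneg_left hcy (Real.exp_pos x).le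
    simp
    linarith
  have h1 := tendsto_integral_rotate (H := fun w => Complex.exp (a * w - Complex.exp w))
    (B := fun x => Real.exp (a * x - Real.cos θ * Real.exp x))
    (B' := fun x => Real.exp (a * x - Real.cos θ * Real.exp x)) hθ (by linarith)
    (by fun_prop) (.of_forall hB) ?_ (.of_forall hB) ?_ (hint θ hcos) (hline θ)
  · have h0 := tendsto_integral_exp_coordinate (hint 0 (by simp))
    have h2 : Tendsto (fun R : ℝ => ∫ x in (-R)..R, Complex.exp (a * x - Complex.exp x)) atTop
        (𝓝 ((Real.Gamma a : ℝ) : ℂ)) := by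
      convert h0 using 2
      · rename_i R
        refine intervalIntegral.integral_congr fun x _ => ?_
        have := hline 0 x
        simpa using this
      · rw [Real.Gamma_eq_integral ha, ← integral_complex_ofReal]
        refine integral_congr_ae (.of_forall fun r => ?_)
        simp [mul_comm]
    have h3 := tendsto_nhds_unique h2 h1
    rw [integral_const_mul] at h3
    rw [h3, ← mul_assoc, ← Complex.exp_add]
    simp
  · exact Real.tendsto_exp_atBot.comp (tendsto_mul_sub_mul_exp_atBot hcos)
  · refine squeeze_zero (fun x => (Real.exp_pos _).le) (g := fun x => Real.exp (a * x))
      (fun x => ?_)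
      (Real.tendsto_exp_atBot.comp (tendsto_id.const_mul_atBot ha))
    refine Real.exp_le_exp.2 ?_
    have := mul_pos hcos (Real.exp_pos x)
    linarith

/-! ### The one-sided stable density -/

lemma integral_rpow_mul_cexp_rotate_neg {a θ : ℝ} (ha : 0 < a) (hθ : 0 ≤ θ)
    (hθ2 : θ < Real.pi / 2) :
    ∫ r in Ioi (0 : ℝ), ((r ^ (a - 1) : ℝ) : ℂ) *
        Complex.exp (-(Complex.exp (-(θ * Complex.I)) * r)) =
      Complex.exp (a * θ * Complex.I) * Real.Gamma a := by
  have h := congrArg (starRingEnd ℂ) (integral_rpow_mul_cexp_rotate ha hθ hθ2)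
  rw [← integral_conj] at h
  simpa [← Complex.exp_conj] using h

lemma integral_rpow_mul_cexp_rotate_scale {a θ t : ℝ} (ha : 0 < a) (hθ : 0 ≤ θ)
    (hθ2 : θ < Real.pi / 2) (ht : 0 < t) :
    ∫ r in Ioi (0 : ℝ), ((r ^ (a - 1) : ℝ) : ℂ) *
        Complex.exp (-(Complex.exp (-(θ * Complex.I)) * (t * r))) =
      (t ^ (-a) : ℝ) * (Complex.exp (a * θ * Complex.I) * Real.Gamma a) := by
  rw [← integral_rpow_mul_cexp_rotate_neg ha hθ hθ2]
  have h := integral_comp_mul_left_Ioi (fun r : ℝ => ((r ^ (a - 1) : ℝ) : ℂ) *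
        Complex.exp (-(Complex.exp (-(θ * Complex.I)) * r))) 0 ht
  rw [mul_zero] at h
  have h2 : (t ^ (-a) : ℝ) = t ^ (-(a - 1)) * t⁻¹ := by
    rw [← Real.rpow_neg_one t, ← Real.rpow_add ht]; ring_nf
  rw [h2, Complex.ofReal_mul, mul_assoc, ← Complex.real_smul (x := t⁻¹), ← h,
    ← integral_const_mul]
  refine setIntegral_congr_fun measurableSet_Ioi fun r hr => ?_
  have hr : 0 < r := hr
  rw [Real.mul_rpow ht.le hr.le, Real.rpow_neg ht.le]
  have : ((t ^ (a - 1) : ℝ) : ℂ) ≠ 0 := by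
    exact_mod_cast (Real.rpow_pos_of_pos ht _).ne'
  push_cast
  field_simp

/-- The integrand `e^{tz - z^q} dz/dr` along the ray `z = e^{iβ} r`. The power `z^q` is written
`e^{iqβ} r^q`, which avoids branches. -/
def stableKernel (q β t r : ℝ) : ℂ :=
  Complex.exp (β * Complex.I) * Complex.exp (Complex.exp (β * Complex.I) * (t * r) -
    Complex.exp ((q * β : ℝ) * Complex.I) * (r ^ q : ℝ))

/-- The one-sided `q`-stable density, as an integral along the ray of angle `β`. The integral
converges absolutely for `t ≥ 0` when `π/2 < β < π` and `qβ < π/2`; by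
`stableDensity_eq_mainardi` the value at `t > 0` does not depend on such a `β`. -/
def stableDensity (q β t : ℝ) : ℝ :=
  (∫ r in Ioi (0 : ℝ), stableKernel q β t r).im / Real.pi

lemma norm_stableKernel (q β t r : ℝ) :
    ‖stableKernel q β t r‖ = Real.exp (t * r * Real.cos β - r ^ q * Real.cos (q * β)) := by
  rw [stableKernel, norm_mul, Complex.norm_exp_ofReal_mul_I, one_mul, Complex.norm_exp,
    Complex.sub_re, Complex.re_mul_ofReal, ← Complex.ofReal_mul, Complex.re_mul_ofReal,
    Complex.exp_ofReal_mul_I_re, Complex.exp_ofReal_mul_I_re]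
  ring_nf

/-- The `n`-th term of the expansion of `stableKernel` in powers of `r ^ q`. -/
def stableTerm (q β t : ℝ) (n : ℕ) (r : ℝ) : ℂ :=
  (Complex.exp (β * Complex.I) * ((-Complex.exp ((q * β : ℝ) * Complex.I)) ^ n / n.factorial)) *
    (((r ^ ((q * n + 1) - 1) : ℝ) : ℂ) *
      Complex.exp (-(Complex.exp (-((Real.pi - β : ℝ) * Complex.I)) * (t * r))))

lemma exp_neg_pi_sub (β : ℝ) : Complex.exp (-((Real.pi - β : ℝ) * Complex.I)) =
    -Complex.exp (β * Complex.I) := by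
  rw [show -(((Real.pi - β : ℝ) : ℂ) * Complex.I) = β * Complex.I - Real.pi * Complex.I by
    push_cast; ring, Complex.exp_sub, Complex.exp_pi_mul_I, div_neg, div_one]

lemma hasSum_stableTerm (q β t : ℝ) {r : ℝ} (hr : 0 < r) :
    HasSum (fun n => stableTerm q β t n r) (stableKernel q β t r) := by
  have h := NormedSpace.expSeries_div_hasSum_exp (𝔸 := ℂ)
    (-(Complex.exp ((q * β : ℝ) * Complex.I) * (r ^ q : ℝ)))
  rw [← Complex.exp_eq_exp_ℂ] at h
  have h2 := h.mul_left (Complex.exp (β * Complex.I) *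
    Complex.exp (Complex.exp (β * Complex.I) * (t * r)))
  have h3 : Complex.exp (β * Complex.I) *
      Complex.exp (Complex.exp (β * Complex.I) * (t * r)) *
      Complex.exp (-(Complex.exp ((q * β : ℝ) * Complex.I) * (r ^ q : ℝ))) =
      stableKernel q β t r := by
    rw [stableKernel, mul_assoc, ← Complex.exp_add]
    ring_nf
  rw [h3] at h2
  refine h2.congr_fun fun n => ?_
  · rw [stableTerm, exp_neg_pi_sub, add_sub_cancel_right, Real.rpow_mul hr.le, Real.rpow_natCast,
      neg_mul, neg_neg, ← neg_mul, mul_pow]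
    push_cast
    ring

lemma norm_stableTerm (q β t : ℝ) (n : ℕ) {r : ℝ} (hr : 0 < r) :
    ‖stableTerm q β t n r‖ =
      (n.factorial : ℝ)⁻¹ * (r ^ ((q * n + 1) - 1) * Real.exp (-(t * -Real.cos β * r))) := by
  rw [stableTerm, exp_neg_pi_sub, norm_mul, norm_mul, Complex.norm_exp_ofReal_mul_I, norm_div,
    norm_pow, norm_neg, Complex.norm_exp_ofReal_mul_I, norm_mul, Complex.norm_real,
    Real.norm_of_nonneg (by positivity), Complex.norm_exp, neg_mul, neg_neg,
    ← Complex.ofReal_mul, Complex.re_mul_ofReal, Complex.exp_ofReal_mul_I_re]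
  simp only [norm_natCast, one_pow, one_div, one_mul]
  ring_nf

lemma cos_neg_of_angle {β : ℝ} (hβ : Real.pi / 2 < β) (hβ2 : β < Real.pi) : Real.cos β < 0 :=
  Real.cos_neg_of_pi_div_two_lt_of_lt hβ (by linarith)

/-- The stable density and the Mainardi function determine each other. Expand `e^{-z^q}` in powers
of `z^q` under the integral; each term is a Gamma integral along a ray. -/
lemma stableDensity_eq_mainardi {q β t : ℝ} (hq : 0 < q) (hq1 : q < 1) (hβ : Real.pi / 2 < β)
    (hβ2 : β < Real.pi) (ht : 0 < t) :
    stableDensity q β t = q * t ^ (-q - 1) * mainardi q (t ^ (-q)) := by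
  have hcos := cos_neg_of_angle hβ hβ2
  have hd : 0 < t * -Real.cos β := by nlinarith
  have hapos : ∀ n : ℕ, 0 < q * n + 1 := fun n => by positivity
  have hint : ∀ n, IntegrableOn (stableTerm q β t n) (Ioi 0) := by
    intro n
    have := (integrableOn_rpow_mul_cexp (a := q * n + 1)
      (c := Complex.exp (-((Real.pi - β : ℝ) * Complex.I)) * t) (hapos n) ?_).const_mul
      (Complex.exp (β * Complex.I) * ((-Complex.exp ((q * β : ℝ) * Complex.I)) ^ n / n.factorial))
    · refine this.congr (.of_forall fun r => ?_)
      simp only [stableTerm, mul_assoc]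
    · rw [exp_neg_pi_sub, Complex.re_mul_ofReal, Complex.neg_re, Complex.exp_ofReal_mul_I_re]
      linarith
  have hnorm : ∀ n : ℕ, ∫ r in Ioi (0 : ℝ), ‖stableTerm q β t n r‖ =
      (t * -Real.cos β)⁻¹ *
        (Real.Gamma (q * n + 1) * ((t * -Real.cos β)⁻¹ ^ q) ^ n / n.factorial) := by
    intro n
    rw [setIntegral_congr_fun measurableSet_Ioi (fun r hr => norm_stableTerm q β t n hr),
      integral_const_mul, Real.integral_rpow_mul_exp_neg_mul_Ioi (hapos n) hd, one_div,
      Real.rpow_add_one (inv_pos.2 hd).ne', Real.rpow_mul (inv_pos.2 hd).le, Real.rpow_natCast]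
    ring
  have hval : ∀ n : ℕ, ∫ r in Ioi (0 : ℝ), stableTerm q β t n r =
      (((-1) ^ n / n.factorial * t ^ (-(q * n + 1)) * Real.Gamma (q * n + 1) : ℝ) : ℂ) *
        Complex.exp ((Real.pi * (q * n + 1) : ℝ) * Complex.I) := by
    intro n
    have hexp : Complex.exp ((Real.pi * (q * n + 1) : ℝ) * Complex.I) =
        Complex.exp (β * Complex.I) * Complex.exp ((q * β : ℝ) * Complex.I) ^ n *
          Complex.exp ((q * n + 1 : ℝ) * (Real.pi - β : ℝ) * Complex.I) := by
      rw [← Complex.exp_nat_mul, ← Complex.exp_add, ← Complex.exp_add]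
      congr 1
      push_cast
      ring
    simp only [stableTerm]
    rw [integral_const_mul, integral_rpow_mul_cexp_rotate_scale (hapos n) (by linarith)
      (by linarith) ht, hexp, neg_pow (Complex.exp _)]
    push_cast
    ring
  have hsum := hasSum_integral_of_summable_integral_norm hint (by
    simp only [hnorm]
    exact (summable_Gamma_mul_pow hq hq1 one_pos (by positivity)).mul_left _)
  rw [setIntegral_congr_fun measurableSet_Ioi
    (fun r hr => (hasSum_stableTerm q β t hr).tsum_eq)] at hsum
  have him := Complex.hasSum_im hsum
  simp only [hval, Complex.im_ofReal_mul, Complex.exp_ofReal_mul_I_im] at him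
  -- The term `n = 0` is a multiple of `sin π`; the others match the series of `M_q` shifted by one.
  rw [← hasSum_nat_add_iff' 1] at him
  simp only [Finset.sum_range_one, Nat.cast_zero, mul_zero, zero_add, mul_one, Real.sin_pi,
    sub_zero] at him
  rw [stableDensity, ← him.tsum_eq, mainardi_eq_tsum_Gamma hq, ← tsum_mul_left, ← tsum_div_const]
  refine tsum_congr fun n => ?_
  have h1 : Real.sin (Real.pi * (q * (n + 1 : ℕ) + 1)) = -Real.sin (Real.pi * (q * n + q)) := by
    rw [← Real.sin_add_pi]; push_cast; ring_nf
  have h2 : Real.Gamma (q * (n + 1 : ℕ) + 1) = (q * n + q) * Real.Gamma (q * n + q) := by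
    rw [← Real.Gamma_add_one (by positivity)]; push_cast; ring_nf
  have h3 : t ^ (-(q * (n + 1 : ℕ) + 1)) = t ^ (-q - 1) * (t ^ (-q)) ^ n := by
    rw [← Real.rpow_natCast, ← Real.rpow_mul ht.le, ← Real.rpow_add ht]; push_cast; ring_nf
  have hf : ((n.factorial : ℝ)) ≠ 0 := by positivity
  rw [h1, h2, h3, Nat.factorial_succ, neg_pow (t ^ (-q)), pow_succ]
  push_cast
  field_simp

/-! ### Cauchy's formula in a sector -/

/-- Subtracting from `e^{-z^q}` the multiple of `1 / (1 + z)` that agrees with it at `z = s` makes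
the pole of `1 / (s - z)` removable. The ray can then be turned onto the positive axis, where the
integrand is real. -/
lemma integral_ray_cauchy_difference {q β s : ℝ} (hq : 0 < q) (hβ : Real.pi / 2 < β)
    (hβ2 : β < Real.pi) (hqβ : q * β < Real.pi / 2) (hs : 0 < s)
    (hint : IntegrableOn (fun r : ℝ => Complex.exp (β * Complex.I) *
      (Complex.exp (-(Complex.exp ((q * β : ℝ) * Complex.I) * (r ^ q : ℝ))) -
        Real.exp (-s ^ q) * (1 + s) / (1 + Complex.exp (β * Complex.I) * r)) /
          (s - Complex.exp (β * Complex.I) * r)) (Ioi 0)) :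
    (∫ r in Ioi (0 : ℝ), Complex.exp (β * Complex.I) *
      (Complex.exp (-(Complex.exp ((q * β : ℝ) * Complex.I) * (r ^ q : ℝ))) -
        Real.exp (-s ^ q) * (1 + s) / (1 + Complex.exp (β * Complex.I) * r)) /
          (s - Complex.exp (β * Complex.I) * r)).im = 0 := by
  set E : ℝ := Real.exp (-s ^ q) with hE
  have hE0 : 0 < E := Real.exp_pos _
  set U : Set ℂ := {w | |w.im| < Real.pi} with hU
  have hUo : IsOpen U := isOpen_lt (by fun_prop) (by fun_prop)
  set N : ℂ → ℂ := fun w => Complex.exp (-Complex.exp (q * w)) - E * (1 + s) / (1 + Complex.exp w)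
    with hN
  set w₀ : ℂ := (Real.log s : ℂ) with hw₀
  have hw₀U : U ∈ 𝓝 w₀ := hUo.mem_nhds (by simp [hU, hw₀, Real.pi_pos])
  have hexp₀ : Complex.exp w₀ = s := by
    rw [hw₀, ← Complex.ofReal_exp, Real.exp_log hs]
  have hNw₀ : N w₀ = 0 := by
    have h1 : Complex.exp (q * w₀) = (s ^ q : ℝ) := by
      rw [hw₀, ← Complex.ofReal_mul, ← Complex.ofReal_exp, mul_comm, Real.rpow_def_of_pos hs]
    have h2 : (1 + s : ℂ) ≠ 0 := by
      have : (1 + s : ℝ) ≠ 0 := by positivity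
      exact_mod_cast this
    simp only [hN]
    rw [hexp₀, h1, mul_div_cancel_right₀ _ h2, hE]
    push_cast
    simp
  have hexpU : ∀ w ∈ U, ∀ v ∈ U, Complex.exp w = Complex.exp v → w = v := by
    intro w hw v hv h
    have hw := abs_lt.1 (show |w.im| < Real.pi from hw)
    have hv := abs_lt.1 (show |v.im| < Real.pi from hv)
    exact Complex.exp_inj_of_neg_pi_lt_of_le_pi hw.1 hw.2.le hv.1 hv.2.le h
  have hone : ∀ w ∈ U, 1 + Complex.exp w ≠ 0 := by
    intro w hw h
    have hw := abs_lt.1 (show |w.im| < Real.pi from hw)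
    have h1 : Complex.exp w = Complex.exp (Real.pi * Complex.I) := by
      rw [Complex.exp_pi_mul_I]; linear_combination h
    have h2 := Complex.exp_inj_of_neg_pi_lt_of_le_pi hw.1 hw.2.le (by simp; linarith [Real.pi_pos])
      (by simp) h1
    rw [h2] at hw
    simp at hw
  have hNd : DifferentiableOn ℂ N U := by
    intro w hw
    refine DifferentiableAt.differentiableWithinAt ?_
    refine DifferentiableAt.sub (by fun_prop) ?_
    exact DifferentiableAt.div (by fun_prop) (by fun_prop) (hone w hw)
  have hslope : ∀ w ∈ U, dslope Complex.exp w₀ w ≠ 0 := by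
    intro w hw
    rcases eq_or_ne w w₀ with rfl | hne
    · rw [dslope_same, Complex.deriv_exp]
      exact Complex.exp_ne_zero _
    · rw [dslope_of_ne _ hne, slope_def_field]
      refine div_ne_zero (sub_ne_zero.2 fun h => hne ?_) (sub_ne_zero.2 hne)
      exact hexpU w hw w₀ (mem_of_mem_nhds hw₀U) h
  -- `H w = N w / (s - e^w) * e^w`, with its removable singularity at `w₀ = log s` filled in.
  set H : ℂ → ℂ := fun w => -(dslope N w₀ w / dslope Complex.exp w₀ w * Complex.exp w) with hH
  have hHd : DifferentiableOn ℂ H U := by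
    refine DifferentiableOn.neg (DifferentiableOn.mul (DifferentiableOn.div ?_ ?_ hslope) ?_)
    · exact (Complex.differentiableOn_dslope hw₀U).2 hNd
    · exact (Complex.differentiableOn_dslope hw₀U).2 Complex.differentiable_exp.differentiableOn
    · exact Complex.differentiable_exp.differentiableOn
  have hHne : ∀ w, w ≠ w₀ → H w = N w / (s - Complex.exp w) * Complex.exp w := by
    intro w hne
    have hne' := sub_ne_zero.2 hne
    simp only [hH]
    rw [dslope_of_ne _ hne, dslope_of_ne _ hne, slope_def_field, slope_def_field, hNw₀, hexp₀,
      sub_zero, div_div_div_cancel_right₀ hne', ← neg_sub (s : ℂ), div_neg]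
    ring
  have hnormexp : ∀ x y : ℝ, ‖Complex.exp (x + y * Complex.I)‖ = Real.exp x := by
    intro x y; simp [Complex.norm_exp]
  have hcosq : 0 < Real.cos (q * β) := Real.cos_pos_of_mem_Ioo ⟨by nlinarith [Real.pi_pos], hqβ⟩
  have hre : ∀ x : ℝ, ∀ y ∈ Icc 0 β, ‖Complex.exp (-Complex.exp (q * (x + y * Complex.I)))‖ ≤
      Real.exp (-(Real.cos (q * β) * Real.exp (q * x))) := by
    intro x y hy
    rw [Complex.norm_exp]
    have h1 : (-Complex.exp (q * (x + y * Complex.I))).re =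
        -(Real.exp (q * x) * Real.cos (q * y)) := by
      simp [Complex.exp_re]
    rw [h1]
    have h2 : Real.cos (q * β) ≤ Real.cos (q * y) :=
      Real.cos_le_cos_of_nonneg_of_le_pi (mul_nonneg hq.le hy.1) (by linarith)
        (mul_le_mul_of_nonneg_left hy.2 hq.le)
    have := mul_le_mul_of_nonneg_left h2 (Real.exp_pos (q * x)).le
    exact Real.exp_le_exp.2 (by linarith)
  have hbound : ∀ x : ℝ, ∀ y ∈ Icc 0 β, ∀ m m' : ℝ, 0 < m → 0 < m' →
      m ≤ |s - Real.exp x| → m' ≤ |1 - Real.exp x| →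
      ‖H (x + y * Complex.I)‖ ≤ (Real.exp (-(Real.cos (q * β) * Real.exp (q * x))) +
        E * (1 + s) / m') / m * Real.exp x := by
    intro x y hy m m' hm hm' h1 h2
    have hs' : ‖(s : ℂ)‖ = s := by simp [hs.le]
    have h3 : |s - Real.exp x| ≤ ‖(s : ℂ) - Complex.exp (x + y * Complex.I)‖ := by
      have := abs_norm_sub_norm_le (s : ℂ) (Complex.exp (x + y * Complex.I))
      rwa [hnormexp, hs'] at this
    have h4 : |1 - Real.exp x| ≤ ‖1 + Complex.exp (x + y * Complex.I)‖ := by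
      have := abs_norm_sub_norm_le (1 : ℂ) (-Complex.exp (x + y * Complex.I))
      rwa [norm_neg, hnormexp, norm_one, sub_neg_eq_add] at this
    have hne : (x + y * Complex.I : ℂ) ≠ w₀ := by
      intro h
      rw [h, hexp₀, sub_self, norm_zero] at h3
      linarith
    rw [hHne _ hne, norm_mul, norm_div, hnormexp]
    have hNn : ‖N (x + y * Complex.I)‖ ≤ Real.exp (-(Real.cos (q * β) * Real.exp (q * x))) +
        E * (1 + s) / m' := by
      refine (norm_sub_le _ _).trans (add_le_add (hre x y hy) ?_)
      rw [norm_div]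
      have : ‖(E : ℂ) * (1 + s)‖ = E * (1 + s) := by
        rw [show (E : ℂ) * (1 + s) = ((E * (1 + s) : ℝ) : ℂ) by push_cast; ring, Complex.norm_real]
        exact Real.norm_of_nonneg (by positivity)
      rw [this]
      exact div_le_div_of_nonneg_left (by positivity) hm' (h2.trans h4)
    gcongr
    exact h1.trans h3
  have key := tendsto_integral_rotate (H := H) (θ := β)
    (B := fun x => (Real.exp (-(Real.cos (q * β) * Real.exp (q * x))) +
        E * (1 + s) / (Real.exp x / 2)) * 2)
    (B' := fun x => ((1 + E * (1 + s) / (1 / 2)) / (s / 2)) * Real.exp x)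
    (by linarith [Real.pi_pos]) hβ2 hHd ?_ ?_ ?_ ?_ hint ?_
  · have hre0 : ∀ R : ℝ, (∫ x in (-R)..R, H x).im = 0 := by
      intro R
      have : ∫ x in (-R)..R, H x = ∫ x in (-R)..R, (((Real.exp (-Real.exp (q * x)) -
          E * (1 + s) / (1 + Real.exp x)) / (s - Real.exp x) * Real.exp x : ℝ) : ℂ) := by
        refine intervalIntegral.integral_congr_ae ?_
        have : ∀ᵐ x : ℝ, x ≠ Real.log s := by
          simp [ae_iff, measure_singleton]
        filter_upwards [this] with x hx _
        rw [hHne _ (by rw [hw₀]; exact_mod_cast hx)]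
        simp only [hN]
        push_cast
        rfl
      rw [this, intervalIntegral.integral_ofReal, Complex.ofReal_im]
    have h := (Complex.continuous_im.tendsto _).comp key
    simp only [Function.comp_def, hre0] at h
    exact (tendsto_nhds_unique h tendsto_const_nhds)
  · filter_upwards [Real.tendsto_exp_atTop.eventually_ge_atTop (2 * (1 + s))] with x hx y hy
    refine (hbound x y hy (Real.exp x / 2) (Real.exp x / 2) (by positivity) (by positivity)
      ?_ ?_).trans (le_of_eq ?_)
    · rw [abs_sub_comm, abs_of_nonneg] <;> linarith
    · rw [abs_sub_comm, abs_of_nonneg] <;> linarith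
    · have := (Real.exp_pos x).ne'
      field_simp
  · have h1 : Tendsto (fun x => Real.exp (-(Real.cos (q * β) * Real.exp (q * x)))) atTop (𝓝 0) :=
      Real.tendsto_exp_atBot.comp (tendsto_neg_atTop_atBot.comp
        ((Real.tendsto_exp_atTop.comp (tendsto_id.const_mul_atTop hq)).const_mul_atTop hcosq))
    have h2 : Tendsto (fun x => E * (1 + s) / (Real.exp x / 2)) atTop (𝓝 0) :=
      tendsto_const_nhds.div_atTop (Real.tendsto_exp_atTop.atTop_div_const two_pos)
    simpa using (h1.add h2).mul_const 2
  · have hev := Real.tendsto_exp_atBot.eventually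
      (gt_mem_nhds (show (0 : ℝ) < min (1 / 2) (s / 2) by positivity))
    filter_upwards [hev] with x hx y hy
    have hx1 := hx.trans_le (min_le_left _ _)
    have hx2 := hx.trans_le (min_le_right _ _)
    refine (hbound x y hy (s / 2) (1 / 2) (by positivity) (by positivity)
      ?_ ?_).trans ?_
    · rw [abs_of_nonneg] <;> linarith
    · rw [abs_of_nonneg] <;> linarith
    · gcongr
      rw [Real.exp_le_one_iff]
      have := mul_pos hcosq (Real.exp_pos (q * x))
      linarith
  · simpa using Real.tendsto_exp_atBot.const_mul ((1 + E * (1 + s) / (1 / 2)) / (s / 2))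
  · intro x
    have hne : (x + β * Complex.I : ℂ) ≠ w₀ := by
      intro h
      have := congrArg Complex.im h
      simp [hw₀] at this
      linarith [Real.pi_pos]
    have h1 : Complex.exp (x + β * Complex.I) = Complex.exp (β * Complex.I) * Real.exp x := by
      rw [Complex.exp_add, Complex.ofReal_exp, mul_comm]
    have h2 : Complex.exp (q * (x + β * Complex.I)) =
        Complex.exp ((q * β : ℝ) * Complex.I) * (Real.exp x ^ q : ℝ) := by
      rw [← Real.exp_mul, Complex.ofReal_exp, ← Complex.exp_add]
      push_cast
      ring_nf
    rw [hHne _ hne]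
    simp only [hN]
    rw [h1, h2, Complex.real_smul]
    ring

/-- The antiderivative `log (1 + z) - log (s - z)` runs from `-log s` to `iπ` along the ray. -/
lemma integral_ray_cauchy_kernel {β s : ℝ} (hβ : Real.pi / 2 < β)
    (hβ2 : β < Real.pi) (hs : 0 < s)
    (hint : IntegrableOn (fun r : ℝ => Complex.exp (β * Complex.I) * (1 + s) /
      (1 + Complex.exp (β * Complex.I) * r) / (s - Complex.exp (β * Complex.I) * r)) (Ioi 0)) :
    (∫ r in Ioi (0 : ℝ), Complex.exp (β * Complex.I) * (1 + s) /
      (1 + Complex.exp (β * Complex.I) * r) / (s - Complex.exp (β * Complex.I) * r)).im =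
      Real.pi := by
  set ω := Complex.exp (β * Complex.I) with hω
  have hsin : 0 < Real.sin β := Real.sin_pos_of_pos_of_lt_pi (by linarith [Real.pi_pos]) hβ2
  have him : ω.im = Real.sin β := Complex.exp_ofReal_mul_I_im β
  have hslit1 : ∀ r : ℝ, 0 ≤ r → 1 + ω * r ∈ Complex.slitPlane := by
    intro r hr
    rw [Complex.mem_slitPlane_iff]
    rcases hr.eq_or_lt with rfl | hr
    · left; simp
    · right; simp [him, hr.ne', hsin.ne']
  have hslit2 : ∀ r : ℝ, 0 ≤ r → s - ω * r ∈ Complex.slitPlane := by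
    intro r hr
    rw [Complex.mem_slitPlane_iff]
    rcases hr.eq_or_lt with rfl | hr
    · left; simpa using hs
    · right; simp [him, hr.ne', hsin.ne']
  have hderiv : ∀ r : ℝ, 0 ≤ r → HasDerivAt
      (fun r : ℝ => Complex.log (1 + ω * r) - Complex.log (s - ω * r))
      (ω * (1 + s) / (1 + ω * r) / (s - ω * r)) r := by
    intro r hr
    have h0 : HasDerivAt (fun r : ℝ => ω * (r : ℂ)) ω r := by
      simpa using (Complex.ofRealCLM.hasDerivAt (x := r)).const_mul ω
    have h1 := (h0.const_add 1).clog_real (hslit1 r hr)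
    have h2 := (h0.const_sub (s : ℂ)).clog_real (hslit2 r hr)
    refine (h1.sub h2).congr_deriv ?_
    have := Complex.slitPlane_ne_zero (hslit1 r hr)
    have := Complex.slitPlane_ne_zero (hslit2 r hr)
    field_simp
    ring
  have hlogω : Complex.log ω = β * Complex.I := by
    rw [hω, Complex.log_exp] <;> simp <;> linarith [Real.pi_pos]
  have hlogω' : Complex.log (-ω) = (β - Real.pi) * Complex.I := by
    have : -ω = Complex.exp ((β - Real.pi : ℝ) * Complex.I) := by
      rw [hω, ← exp_neg_pi_sub]; push_cast; ring_nf
    rw [this, Complex.log_exp] <;> simp <;> linarith [Real.pi_pos]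
  have hlim : Tendsto (fun r : ℝ => Complex.log (1 + ω * r) - Complex.log (s - ω * r)) atTop
      (𝓝 (Real.pi * Complex.I)) := by
    -- Divide both arguments by `r`; the terms `log r` cancel.
    have hinv : Tendsto (fun r : ℝ => ((r⁻¹ : ℝ) : ℂ)) atTop (𝓝 0) := by
      simpa [Function.comp_def] using
        (Complex.continuous_ofReal.tendsto 0).comp tendsto_inv_atTop_zero
    have h1 : Tendsto (fun r : ℝ => Complex.log (((r⁻¹ : ℝ) : ℂ) + ω)) atTop
        (𝓝 (Complex.log ω)) := by
      refine Tendsto.clog (by simpa using hinv.add_const ω) ?_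
      rw [Complex.mem_slitPlane_iff]; right; rw [him]; exact hsin.ne'
    have h2 : Tendsto (fun r : ℝ => Complex.log (s * ((r⁻¹ : ℝ) : ℂ) - ω)) atTop
        (𝓝 (Complex.log (-ω))) := by
      refine Tendsto.clog (by simpa using (hinv.const_mul (s : ℂ)).sub_const ω) ?_
      rw [Complex.mem_slitPlane_iff]; right; rw [Complex.neg_im, him]
      exact (neg_neg_of_pos hsin).ne
    have h3 := h1.sub h2
    rw [hlogω, hlogω', show (β * Complex.I - (β - Real.pi) * Complex.I : ℂ) =
      Real.pi * Complex.I by ring] at h3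
    refine h3.congr' ?_
    filter_upwards [eventually_gt_atTop 0] with r hr
    have hr' : (r : ℂ) ≠ 0 := by exact_mod_cast hr.ne'
    have e1 : 1 + ω * r = r * (((r⁻¹ : ℝ) : ℂ) + ω) := by push_cast; field_simp
    have e2 : s - ω * r = r * (s * ((r⁻¹ : ℝ) : ℂ) - ω) := by push_cast; field_simp
    have n1 := Complex.slitPlane_ne_zero (hslit1 r hr.le)
    have n2 := Complex.slitPlane_ne_zero (hslit2 r hr.le)
    rw [e1] at n1 ⊢
    rw [e2] at n2 ⊢
    rw [Complex.log_ofReal_mul hr (right_ne_zero_of_mul n1),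
      Complex.log_ofReal_mul hr (right_ne_zero_of_mul n2)]
    ring
  rw [integral_Ioi_of_hasDerivAt_of_tendsto (hderiv 0 le_rfl).continuousAt.continuousWithinAt
    (fun r hr => hderiv r (le_of_lt hr)) hint hlim]
  simp [Complex.log_im, Complex.arg_ofReal_of_nonneg hs.le]

/-! ### The Laplace transform of the stable density -/

lemma le_norm_sub_ray {β s r : ℝ} (hcos : Real.cos β < 0) (hr : 0 ≤ r) :
    s ≤ ‖(s : ℂ) - Complex.exp (β * Complex.I) * r‖ := by
  refine le_trans ?_ (Complex.re_le_norm _)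
  rw [Complex.sub_re, Complex.re_mul_ofReal, Complex.exp_ofReal_mul_I_re, Complex.ofReal_re]
  nlinarith

lemma ray_denominators_lower_bound {β s r : ℝ} (hcos : Real.cos β < 0) (hcos1 : -1 < Real.cos β)
    (hs : 0 < s) (hr : 0 ≤ r) :
    √((1 + Real.cos β) * min 1 (s ^ 2)) * (1 + r ^ 2) ≤
      ‖1 + Complex.exp (β * Complex.I) * r‖ * ‖(s : ℂ) - Complex.exp (β * Complex.I) * r‖ := by
  have hsc := Real.sin_sq_add_cos_sq β
  have h1 : (1 + Real.cos β) * (1 + r ^ 2) ≤ ‖1 + Complex.exp (β * Complex.I) * r‖ ^ 2 := by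
    rw [← Complex.normSq_eq_norm_sq, Complex.normSq_apply]
    simp only [Complex.add_re, Complex.one_re, Complex.re_mul_ofReal, Complex.exp_ofReal_mul_I_re,
      Complex.add_im, Complex.one_im, Complex.im_mul_ofReal, Complex.exp_ofReal_mul_I_im]
    nlinarith [sq_nonneg (1 - r)]
  have h2 : min 1 (s ^ 2) * (1 + r ^ 2) ≤ ‖(s : ℂ) - Complex.exp (β * Complex.I) * r‖ ^ 2 := by
    rw [← Complex.normSq_eq_norm_sq, Complex.normSq_apply]
    simp only [Complex.sub_re, Complex.ofReal_re, Complex.re_mul_ofReal,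
      Complex.exp_ofReal_mul_I_re, Complex.sub_im, Complex.ofReal_im, Complex.im_mul_ofReal,
      Complex.exp_ofReal_mul_I_im]
    have m1 : min 1 (s ^ 2) ≤ 1 := min_le_left _ _
    have m2 : min 1 (s ^ 2) ≤ s ^ 2 := min_le_right _ _
    have m3 : min 1 (s ^ 2) * r ^ 2 ≤ r ^ 2 := by nlinarith [sq_nonneg r]
    have e : (s - Real.cos β * r) * (s - Real.cos β * r) +
      (0 - Real.sin β * r) * (0 - Real.sin β * r) = s ^ 2 + r ^ 2 - 2 * (s * r * Real.cos β) := by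
      linear_combination r ^ 2 * hsc
    have m4 : s * r * Real.cos β ≤ 0 := mul_nonpos_of_nonneg_of_nonpos (by positivity) hcos.le
    rw [e]
    linarith
  have hm : 0 < min 1 (s ^ 2) := by positivity
  have hc : 0 < 1 + Real.cos β := by linarith
  refine le_of_sq_le_sq ?_ (by positivity)
  rw [mul_pow, mul_pow, Real.sq_sqrt (by positivity)]
  calc (1 + Real.cos β) * min 1 (s ^ 2) * (1 + r ^ 2) ^ 2
      = ((1 + Real.cos β) * (1 + r ^ 2)) * (min 1 (s ^ 2) * (1 + r ^ 2)) := by ring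
    _ ≤ _ := by gcongr

lemma continuousOn_ray_inv {β s : ℝ} (hcos : Real.cos β < 0) (hs : 0 < s) :
    ContinuousOn (fun r : ℝ => ((s : ℂ) - Complex.exp (β * Complex.I) * r)⁻¹) (Ioi 0) := by
  refine ContinuousOn.inv₀ (by fun_prop) fun r hr h => ?_
  have := le_norm_sub_ray (s := s) hcos (le_of_lt (mem_Ioi.1 hr))
  rw [h, norm_zero] at this
  linarith

lemma integrableOn_ray_cauchy_kernel {β s : ℝ} (hcos : Real.cos β < 0) (hcos1 : -1 < Real.cos β)
    (hs : 0 < s) :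
    IntegrableOn (fun r : ℝ => Complex.exp (β * Complex.I) * (1 + s) /
      (1 + Complex.exp (β * Complex.I) * r) / (s - Complex.exp (β * Complex.I) * r)) (Ioi 0) := by
  set m := √((1 + Real.cos β) * min 1 (s ^ 2)) with hm
  have hmpos : 0 < m := Real.sqrt_pos.2 (mul_pos (by linarith) (by positivity))
  have hdom : IntegrableOn (fun r : ℝ => (1 + s) / m * (1 + r ^ 2)⁻¹) (Ioi 0) :=
    (integrable_inv_one_add_sq.const_mul _).integrableOn
  have hlow := fun r (hr : r ∈ Ioi (0 : ℝ)) =>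
    ray_denominators_lower_bound hcos hcos1 hs (le_of_lt (mem_Ioi.1 hr))
  refine hdom.mono' (ContinuousOn.aestronglyMeasurable ?_ measurableSet_Ioi) ?_
  · simp only [div_eq_mul_inv]
    refine ContinuousOn.mul (ContinuousOn.mul (by fun_prop) ?_) (continuousOn_ray_inv hcos hs)
    refine ContinuousOn.inv₀ (by fun_prop) fun r hr h => ?_
    have := hlow r hr
    rw [h, norm_zero, zero_mul, ← hm] at this
    have : 0 < m * (1 + r ^ 2) := by positivity
    linarith
  · refine (ae_restrict_iff' measurableSet_Ioi).2 (.of_forall fun r hr => ?_)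
    rw [norm_div, norm_div, norm_mul, Complex.norm_exp_ofReal_mul_I, one_mul, div_div]
    have h1 : ‖(1 : ℂ) + s‖ = 1 + s := by
      rw [show (1 : ℂ) + s = ((1 + s : ℝ) : ℂ) by push_cast; ring, Complex.norm_real]
      exact Real.norm_of_nonneg (by positivity)
    rw [h1, ← div_eq_mul_inv, div_div]
    exact div_le_div_of_nonneg_left (by positivity) (by positivity) (hlow r hr)

lemma integrableOn_exp_neg_mul_rpow {q c : ℝ} (hq : 0 < q) (hc : 0 < c) :
    IntegrableOn (fun r : ℝ => Real.exp (-(r ^ q * c))) (Ioi 0) := by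
  have := integrableOn_rpow_mul_exp_neg_mul_rpow (p := q) (s := 0) (b := c) (by norm_num) hq hc
  refine this.congr (.of_forall fun r => ?_)
  simp [mul_comm]

lemma integrableOn_ray_stable {q β s : ℝ} (hq : 0 < q) (hcos : Real.cos β < 0)
    (hcosq : 0 < Real.cos (q * β)) (hs : 0 < s) :
    IntegrableOn (fun r : ℝ => Complex.exp (β * Complex.I) *
      Complex.exp (-(Complex.exp ((q * β : ℝ) * Complex.I) * (r ^ q : ℝ))) /
          (s - Complex.exp (β * Complex.I) * r)) (Ioi 0) := by
  refine ((integrableOn_exp_neg_mul_rpow hq hcosq).mul_const s⁻¹).mono'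
    (ContinuousOn.aestronglyMeasurable ?_ measurableSet_Ioi) ?_
  · simp only [div_eq_mul_inv]
    refine ContinuousOn.mul ?_ (continuousOn_ray_inv hcos hs)
    have : Continuous fun r : ℝ => r ^ q := Real.continuous_rpow_const hq.le
    fun_prop
  · refine (ae_restrict_iff' measurableSet_Ioi).2 (.of_forall fun r hr => ?_)
    rw [norm_div, norm_mul, Complex.norm_exp_ofReal_mul_I, one_mul, Complex.norm_exp,
      Complex.neg_re, Complex.re_mul_ofReal, Complex.exp_ofReal_mul_I_re, mul_comm (Real.cos _),
      ← div_eq_mul_inv]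
    exact div_le_div_of_nonneg_left (by positivity) hs
      (le_norm_sub_ray hcos (le_of_lt (mem_Ioi.1 hr)))

/-- Cauchy's formula for `e^{-z^q}` in the sector between the ray and the positive axis: on the
axis the integrand is real, so that only half the residue at `z = s` enters the imaginary part. -/
lemma integral_ray_stable {q β s : ℝ} (hq : 0 < q) (hβ : Real.pi / 2 < β)
    (hβ2 : β < Real.pi) (hqβ : q * β < Real.pi / 2) (hs : 0 < s) :
    (∫ r in Ioi (0 : ℝ), Complex.exp (β * Complex.I) *
      Complex.exp (-(Complex.exp ((q * β : ℝ) * Complex.I) * (r ^ q : ℝ))) /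
          (s - Complex.exp (β * Complex.I) * r)).im = Real.pi * Real.exp (-s ^ q) := by
  have hcos := cos_neg_of_angle hβ hβ2
  have hcosq : 0 < Real.cos (q * β) := Real.cos_pos_of_mem_Ioo ⟨by nlinarith [Real.pi_pos], hqβ⟩
  have hcos1 : -1 < Real.cos β := by
    rw [← Real.cos_pi]
    exact Real.cos_lt_cos_of_nonneg_of_le_pi (by linarith [Real.pi_pos]) le_rfl hβ2
  have h1 := integrableOn_ray_stable hq hcos hcosq hs
  have h2 := integrableOn_ray_cauchy_kernel hcos hcos1 hs
  have hint := h1.sub (h2.const_mul (Real.exp (-s ^ q) : ℂ))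
  have hdiff := integral_ray_cauchy_difference hq hβ hβ2 hqβ hs (hint.congr (.of_forall fun r => by
    simp only [Pi.sub_apply]; ring))
  have hsub := congrArg Complex.im (integral_sub h1 (h2.const_mul (Real.exp (-s ^ q) : ℂ)))
  rw [integral_const_mul, Complex.sub_im, Complex.im_ofReal_mul,
    integral_ray_cauchy_kernel hβ hβ2 hs h2] at hsub
  have heq := hdiff.symm.trans ((congrArg Complex.im (integral_congr_ae (.of_forall fun r => by
    ring))).trans hsub)
  linarith

lemma integrable_laplace_stableKernel {q β s : ℝ} (hq : 0 < q) (hcos : Real.cos β < 0)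
    (hcosq : 0 < Real.cos (q * β)) (hs : 0 < s) :
    Integrable (Function.uncurry fun t r : ℝ => Real.exp (-(s * t)) • stableKernel q β t r)
      ((volume.restrict (Ioi 0)).prod (volume.restrict (Ioi 0))) := by
  have h1 : IntegrableOn (fun t : ℝ => Real.exp (-(s * t))) (Ioi 0) := by
    simpa using exp_neg_integrableOn_Ioi 0 hs
  refine (h1.mul_prod (integrableOn_exp_neg_mul_rpow hq hcosq)).mono' ?_ ?_
  · refine Continuous.aestronglyMeasurable ?_
    have : Continuous fun r : ℝ => r ^ q := Real.continuous_rpow_const hq.le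
    unfold stableKernel Function.uncurry
    fun_prop
  · rw [Measure.prod_restrict]
    refine (ae_restrict_iff' (measurableSet_Ioi.prod measurableSet_Ioi)).2
      (.of_forall fun p hp => ?_)
    have h1 : 0 < p.1 := hp.1
    have h2 : 0 < p.2 := hp.2
    simp only [Function.uncurry]
    rw [norm_smul, norm_stableKernel, Real.norm_of_nonneg (Real.exp_pos _).le]
    gcongr
    have : p.1 * p.2 * Real.cos β ≤ 0 := mul_nonpos_of_nonneg_of_nonpos (by positivity) hcos.le
    linarith

/-- The stable density has Laplace transform `e^{-s^q}`. -/
lemma integral_stableDensity_laplace {q β s : ℝ} (hq : 0 < q) (hβ : Real.pi / 2 < β)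
    (hβ2 : β < Real.pi) (hqβ : q * β < Real.pi / 2) (hs : 0 < s) :
    IntegrableOn (fun t => Real.exp (-(s * t)) * stableDensity q β t) (Ioi 0) ∧
    ∫ t in Ioi (0 : ℝ), Real.exp (-(s * t)) * stableDensity q β t = Real.exp (-s ^ q) := by
  have hcos := cos_neg_of_angle hβ hβ2
  have hcosq : 0 < Real.cos (q * β) := Real.cos_pos_of_mem_Ioo ⟨by nlinarith [Real.pi_pos], hqβ⟩
  have hint := integrable_laplace_stableKernel hq hcos hcosq hs
  have hfac : ∀ t : ℝ, Real.exp (-(s * t)) * stableDensity q β t =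
      (∫ r in Ioi (0 : ℝ), Real.exp (-(s * t)) • stableKernel q β t r).im / Real.pi := by
    intro t
    rw [integral_smul, stableDensity, Complex.smul_im, smul_eq_mul]
    ring
  have h1 := hint.integral_prod_left
  simp only [Function.uncurry] at h1
  have h1im := h1.im.div_const Real.pi
  constructor
  · refine h1im.congr (.of_forall fun t => ?_)
    exact (hfac t).symm
  · simp only [hfac]
    have hinner : ∀ r ∈ Ioi (0 : ℝ),
        ∫ t in Ioi (0 : ℝ), Real.exp (-(s * t)) • stableKernel q β t r =
          Complex.exp (β * Complex.I) *
            Complex.exp (-(Complex.exp ((q * β : ℝ) * Complex.I) * (r ^ q : ℝ))) /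
              (s - Complex.exp (β * Complex.I) * r) := by
      intro r hr
      have hr0 : 0 < r := hr
      have hre : (Complex.exp (β * Complex.I) * r - s).re < 0 := by
        rw [Complex.sub_re, Complex.re_mul_ofReal, Complex.exp_ofReal_mul_I_re, Complex.ofReal_re]
        nlinarith
      have hexp := integral_exp_mul_complex_Ioi hre 0
      rw [Complex.ofReal_zero, mul_zero, Complex.exp_zero] at hexp
      calc ∫ t in Ioi (0 : ℝ), Real.exp (-(s * t)) • stableKernel q β t r
          = ∫ t in Ioi (0 : ℝ), (Complex.exp (β * Complex.I) *
            Complex.exp (-(Complex.exp ((q * β : ℝ) * Complex.I) * (r ^ q : ℝ)))) *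
              Complex.exp ((Complex.exp (β * Complex.I) * r - s) * t) := by
            refine integral_congr_ae (.of_forall fun t => ?_)
            simp only [stableKernel, Complex.real_smul, Complex.ofReal_exp, ← Complex.exp_add]
            congr 1
            push_cast
            ring
        _ = _ := by
            rw [integral_const_mul, hexp, ← neg_sub (s : ℂ), neg_div_neg_eq, mul_one_div]
    have him := Complex.imCLM.integral_comp_comm h1
    simp only [Complex.imCLM_apply] at him
    rw [integral_div, him, integral_integral_swap hint,
      setIntegral_congr_fun measurableSet_Ioi hinner, integral_ray_stable hq hβ hβ2 hqβ hs]
    field_simp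

/-! ### Positivity from complete monotonicity -/

section Laplace
variable {h : ℝ → ℝ}

lemma integrableOn_pow_mul_exp_neg
    (hint : ∀ s : ℝ, 0 < s → IntegrableOn (fun t => Real.exp (-(s * t)) * h t) (Ioi 0))
    (n : ℕ) {s : ℝ} (hs : 0 < s) :
    IntegrableOn (fun t => t ^ n * (Real.exp (-(s * t)) * h t)) (Ioi 0) := by
  have h2 := (hint (s / 2) (by positivity)).norm.const_mul (n.factorial * (2 / s) ^ n)
  refine h2.mono' ((continuous_pow n).aestronglyMeasurable.mul (hint s hs).aestronglyMeasurable) ?_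
  refine (ae_restrict_iff' measurableSet_Ioi).2 (.of_forall fun t ht => ?_)
  have ht : 0 < t := ht
  rw [norm_mul, norm_mul, norm_mul, Real.norm_of_nonneg (Real.exp_pos _).le,
    Real.norm_of_nonneg (Real.exp_pos _).le, Real.norm_of_nonneg (by positivity : 0 ≤ t ^ n),
    ← mul_assoc, ← mul_assoc]
  refine mul_le_mul_of_nonneg_right ?_ (norm_nonneg _)
  have hpow := Real.pow_div_factorial_le_exp (s / 2 * t) (by positivity) n
  rw [div_le_iff₀ (by positivity), mul_pow] at hpow
  have hexp : Real.exp (-(s * t)) = Real.exp (-(s / 2 * t)) * Real.exp (-(s / 2 * t)) := by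
    rw [← Real.exp_add]; ring_nf
  have hone : Real.exp (s / 2 * t) * Real.exp (-(s / 2 * t)) = 1 := by
    rw [← Real.exp_add]; simp
  have hs2 : (2 / s) ^ n * (s / 2) ^ n = 1 := by
    rw [← mul_pow]; field_simp; simp
  have hbound : t ^ n ≤ n.factorial * (2 / s) ^ n * Real.exp (s / 2 * t) := by
    calc t ^ n = (2 / s) ^ n * ((s / 2) ^ n * t ^ n) := by rw [← mul_assoc, hs2, one_mul]
      _ ≤ (2 / s) ^ n * (Real.exp (s / 2 * t) * n.factorial) := by gcongr
      _ = _ := by ring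
  calc t ^ n * Real.exp (-(s * t))
      ≤ (n.factorial * (2 / s) ^ n * Real.exp (s / 2 * t)) * Real.exp (-(s * t)) := by gcongr
    _ = n.factorial * (2 / s) ^ n * (Real.exp (s / 2 * t) * Real.exp (-(s / 2 * t))) *
          Real.exp (-(s / 2 * t)) := by rw [hexp]; ring
    _ = _ := by rw [hone, mul_one]

lemma hasDerivAt_integral_pow_mul_exp_neg
    (hint : ∀ s : ℝ, 0 < s → IntegrableOn (fun t => Real.exp (-(s * t)) * h t) (Ioi 0))
    (n : ℕ) {s : ℝ} (hs : 0 < s) :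
    HasDerivAt (fun s => ∫ t in Ioi (0 : ℝ), t ^ n * (Real.exp (-(s * t)) * h t))
      (-∫ t in Ioi (0 : ℝ), t ^ (n + 1) * (Real.exp (-(s * t)) * h t)) s := by
  rw [← integral_neg]
  refine (hasDerivAt_integral_of_dominated_loc_of_deriv_le (s := Ioi (s / 2))
    (bound := fun t => ‖t ^ (n + 1) * (Real.exp (-(s / 2 * t)) * h t)‖)
    (F := fun s t => t ^ n * (Real.exp (-(s * t)) * h t))
    (F' := fun s t => -(t ^ (n + 1) * (Real.exp (-(s * t)) * h t)))
    (Ioi_mem_nhds (by linarith)) ?_ (integrableOn_pow_mul_exp_neg hint n hs)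
    (integrableOn_pow_mul_exp_neg hint (n + 1) hs).neg.aestronglyMeasurable ?_
    (integrableOn_pow_mul_exp_neg hint (n + 1) (half_pos hs)).norm ?_).2
  · filter_upwards [Ioi_mem_nhds hs] with s' hs'
    exact (integrableOn_pow_mul_exp_neg hint n hs').aestronglyMeasurable
  · refine (ae_restrict_iff' measurableSet_Ioi).2 (.of_forall fun t ht s' hs' => ?_)
    have ht : 0 < t := ht
    have hs' : s / 2 < s' := hs'
    rw [norm_neg, norm_mul, norm_mul, norm_mul, norm_mul, Real.norm_of_nonneg (Real.exp_pos _).le,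
      Real.norm_of_nonneg (Real.exp_pos _).le]
    gcongr
  · refine .of_forall fun t s' _ => ?_
    have h1 : HasDerivAt (fun s : ℝ => Real.exp (-(s * t))) (Real.exp (-(s' * t)) * -t) s' := by
      have := ((hasDerivAt_id s').mul_const t).neg.exp
      simpa using this
    refine ((h1.mul_const (h t)).const_mul (t ^ n)).congr_deriv ?_
    ring

/-- A continuous function all of whose integrals `∫ tⁿ e^{-st} h(t) dt` are nonnegative is itself
nonnegative: for `s = n / t₀` the weight `(t e^{-t/t₀})ⁿ` concentrates at `t₀`. This is the
positivity part of the Post–Widder inversion of the Laplace transform. -/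
lemma nonneg_of_integral_pow_mul_exp_nonneg
    (hint : ∀ s : ℝ, 0 < s → IntegrableOn (fun t => Real.exp (-(s * t)) * h t) (Ioi 0))
    (hcont : ContinuousOn h (Ioi 0))
    (hnn : ∀ n : ℕ, ∀ s : ℝ, 0 < s → 0 ≤ ∫ t in Ioi (0 : ℝ), t ^ n * (Real.exp (-(s * t)) * h t))
    {t₀ : ℝ} (ht₀ : 0 < t₀) : 0 ≤ h t₀ := by
  by_contra! hneg
  set c : ℝ → ℝ := fun u => u * Real.exp (-(t₀⁻¹ * u)) with hc
  have hcc : Continuous c := by fun_prop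
  have hcpos : ∀ u, 0 < u → 0 < c u := fun u hu => by positivity
  -- The condition says that `u` lies farther from `t₀` than `a`, on the same side.
  have hmono : ∀ u a : ℝ, 0 < u → 0 < a → (u - a) / a ≤ (u - a) / t₀ → c u ≤ c a := by
    intro u a hu ha hua
    have h1 := Real.add_one_le_exp ((u - a) / t₀)
    have h2 : u ≤ a * Real.exp ((u - a) / t₀) := by
      have : u = a * ((u - a) / a + 1) := by field_simp; ring
      calc u = a * ((u - a) / a + 1) := this
        _ ≤ _ := by gcongr; linarith
    calc c u ≤ (a * Real.exp ((u - a) / t₀)) * Real.exp (-(t₀⁻¹ * u)) := by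
          simp only [hc]; gcongr
      _ = c a := by
          rw [mul_assoc, ← Real.exp_add]
          simp only [hc]
          congr 2
          field_simp
          ring
  have hstrict : ∀ a : ℝ, 0 < a → a ≠ t₀ → c a < c t₀ := by
    intro a ha hne
    have h1 := Real.add_one_lt_exp (x := (a - t₀) / t₀)
      (div_ne_zero (sub_ne_zero.2 hne) ht₀.ne')
    have h2 : a < t₀ * Real.exp ((a - t₀) / t₀) := by
      have : a = t₀ * ((a - t₀) / t₀ + 1) := by field_simp; ring
      calc a = t₀ * ((a - t₀) / t₀ + 1) := this
        _ < _ := by gcongr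
    calc c a < (t₀ * Real.exp ((a - t₀) / t₀)) * Real.exp (-(t₀⁻¹ * a)) := by
          simp only [hc]; gcongr
      _ = c t₀ := by
          rw [mul_assoc, ← Real.exp_add]
          simp only [hc]
          congr 2
          field_simp
          ring
  obtain ⟨ε, hε, hεh⟩ : ∃ ε > 0, h t₀ < -ε := ⟨-h t₀ / 2, by linarith, by linarith⟩
  have hev : ∀ᶠ u in 𝓝 t₀, h u < -ε :=
    (hcont.continuousAt (Ioi_mem_nhds ht₀)).eventually (gt_mem_nhds hεh)
  obtain ⟨δ₀, hδ₀, hδ₀h⟩ := Metric.eventually_nhds_iff.1 hev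
  set δ := min (δ₀ / 2) (t₀ / 2) with hδ
  have hδpos : 0 < δ := by positivity
  have hδ1 : δ ≤ δ₀ / 2 := min_le_left _ _
  have hδ2 : δ ≤ t₀ / 2 := min_le_right _ _
  have hnear : ∀ u, |u - t₀| ≤ δ → h u < -ε := fun u hu => hδ₀h (by
    rw [Real.dist_eq]; linarith)
  set ρ := max (c (t₀ - δ)) (c (t₀ + δ)) with hρ
  have hρpos : 0 < ρ := lt_max_of_lt_right (hcpos _ (by positivity))
  have hρlt : ρ < c t₀ := max_lt (hstrict _ (by linarith) (by linarith))
    (hstrict _ (by linarith) (by linarith))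
  have hfar : ∀ u, 0 < u → δ < |u - t₀| → c u ≤ ρ := by
    intro u hu hfar
    rcases lt_abs.1 hfar with h1 | h1
    · refine (hmono u (t₀ + δ) hu (by positivity) ?_).trans (le_max_right _ _)
      exact div_le_div_of_nonneg_left (by linarith) ht₀ (by linarith)
    · refine (hmono u (t₀ - δ) hu (by linarith) ?_).trans (le_max_left _ _)
      rw [← neg_sub, neg_div, neg_div, neg_le_neg_iff]
      exact div_le_div_of_nonneg_left (by linarith) (by linarith) (by linarith)
  obtain ⟨m, hm1, hm2⟩ := exists_between hρlt
  have hmpos : 0 < m := hρpos.trans hm1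
  obtain ⟨η₀, hη₀, hη₀c⟩ := Metric.eventually_nhds_iff.1
    (hcc.continuousAt.eventually (lt_mem_nhds hm2))
  set η := min (η₀ / 2) δ with hη
  have hηpos : 0 < η := by positivity
  have hη1 : η ≤ η₀ / 2 := min_le_left _ _
  have hη2 : η ≤ δ := min_le_right _ _
  set S := Icc (t₀ - η) (t₀ + η) with hS
  have hSsub : S ⊆ Ioi 0 := fun u hu => by
    have := hu.1
    change 0 < u
    linarith
  have hcInt : IntegrableOn (fun u => c u * |h u|) (Ioi 0) := by
    have := (integrableOn_pow_mul_exp_neg hint 1 (inv_pos.2 ht₀)).norm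
    refine (integrableOn_congr_fun (fun u hu => ?_) measurableSet_Ioi).1 this
    have hu : 0 < u := hu
    rw [norm_mul, norm_mul, Real.norm_of_nonneg (Real.exp_pos _).le, pow_one,
      Real.norm_of_nonneg hu.le, Real.norm_eq_abs]
    simp only [hc]
    ring
  set I := ∫ u in Ioi (0 : ℝ), c u * |h u| with hI
  -- Pointwise, `cⁿ⁺¹ h` is at most `ρⁿ c |h|`, and at most `-ε mⁿ⁺¹` within `η` of `t₀`.
  have hineq : ∀ n : ℕ, ε * m ^ (n + 1) * (2 * η) ≤ ρ ^ n * I := by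
    intro n
    have hmom := hnn (n + 1) ((n + 1) * t₀⁻¹) (by positivity)
    have hmomint := integrableOn_pow_mul_exp_neg hint (n + 1)
      (s := (n + 1) * t₀⁻¹) (by positivity)
    have hind : IntegrableOn (S.indicator fun _ => ε * m ^ (n + 1)) (Ioi 0) := by
      refine Integrable.integrableOn ?_
      refine (integrable_indicator_iff measurableSet_Icc).2 ?_
      exact integrableOn_const (by simp)
    have hle : ∫ t in Ioi (0 : ℝ), t ^ (n + 1) * (Real.exp (-((n + 1) * t₀⁻¹ * t)) * h t) ≤
        ∫ t in Ioi (0 : ℝ), (ρ ^ n * (c t * |h t|) - S.indicator (fun _ => ε * m ^ (n + 1)) t) := by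
      refine setIntegral_mono_on hmomint ((hcInt.const_mul _).sub hind) measurableSet_Ioi ?_
      intro u hu
      have hu : 0 < u := hu
      have hpow : u ^ (n + 1) * (Real.exp (-((n + 1) * t₀⁻¹ * u)) * h u) = c u ^ (n + 1) * h u := by
        simp only [hc]
        rw [mul_pow, ← Real.exp_nat_mul, mul_assoc]
        push_cast
        ring_nf
      rw [hpow]
      have hcu := hcpos u hu
      by_cases huS : u ∈ S
      · rw [indicator_of_mem huS]
        have hu' : |u - t₀| ≤ η := abs_le.2 ⟨by linarith [huS.1], by linarith [huS.2]⟩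
        have h1 : h u < -ε := hnear u (hu'.trans hη2)
        have h2 : m < c u := hη₀c (by rw [Real.dist_eq]; linarith)
        have h3 : m ^ (n + 1) ≤ c u ^ (n + 1) := by gcongr
        have h4 : 0 ≤ ρ ^ n * (c u * |h u|) := by positivity
        have h5 : 0 < m ^ (n + 1) := by positivity
        nlinarith
      · rw [indicator_of_notMem huS, sub_zero]
        rcases le_or_gt |u - t₀| δ with h1 | h1
        · have h2 := hnear u h1
          have h3 : c u ^ (n + 1) * h u ≤ 0 :=
            mul_nonpos_of_nonneg_of_nonpos (by positivity) (by linarith)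
          have h4 : 0 ≤ ρ ^ n * (c u * |h u|) := by positivity
          linarith
        · have h2 := hfar u hu h1
          calc c u ^ (n + 1) * h u ≤ c u ^ (n + 1) * |h u| := by gcongr; exact le_abs_self _
            _ = c u ^ n * (c u * |h u|) := by ring
            _ ≤ _ := by gcongr
    rw [integral_sub (hcInt.const_mul _) hind, integral_const_mul,
      setIntegral_indicator measurableSet_Icc, inter_eq_self_of_subset_right hSsub,
      setIntegral_const, Measure.real, Real.volume_Icc, ENNReal.toReal_ofReal (by linarith),
      smul_eq_mul] at hle
    have : t₀ + η - (t₀ - η) = 2 * η := by ring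
    rw [this] at hle
    linarith
  -- Since `m > ρ`, that inequality fails for large `n`.
  have hgrow : Tendsto (fun n : ℕ => (ε * m * (2 * η)) * (m / ρ) ^ n) atTop atTop :=
    (tendsto_pow_atTop_atTop_of_one_lt ((one_lt_div hρpos).2 hm1)).const_mul_atTop (by positivity)
  obtain ⟨n, hn⟩ := (hgrow.eventually_gt_atTop I).exists
  have hpρ : 0 < ρ ^ n := by positivity
  rw [div_pow, mul_div_assoc', lt_div_iff₀ hpρ] at hn
  have := hineq n
  have e : ε * m * (2 * η) * m ^ n = ε * m ^ (n + 1) * (2 * η) := by ring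
  linarith

end Laplace

/-- The cone of functions generated by `s ↦ s^{-a} e^{-s^q}`, `a ≥ 0`. For `0 < q < 1` it is
stable under `-d/ds`, so its members are completely monotone on `(0, ∞)`. -/
inductive StableCone (q : ℝ) : (ℝ → ℝ) → Prop
  | base (a : ℝ) (ha : 0 ≤ a) : StableCone q fun s => s ^ (-a) * Real.exp (-s ^ q)
  | add (f g : ℝ → ℝ) (hf : StableCone q f) (hg : StableCone q g) : StableCone q fun s => f s + g s
  | smul (c : ℝ) (hc : 0 ≤ c) (f : ℝ → ℝ) (hf : StableCone q f) : StableCone q fun s => c * f s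

lemma StableCone.nonneg {q : ℝ} {f : ℝ → ℝ} (hf : StableCone q f) {s : ℝ} (hs : 0 < s) :
    0 ≤ f s := by
  induction hf with
  | base a ha => positivity
  | add f g _ _ h1 h2 => exact add_nonneg h1 h2
  | smul c hc f _ h1 => exact mul_nonneg hc h1

lemma StableCone.exists_hasDerivAt {q : ℝ} (hq : 0 < q) (hq1 : q < 1) {f : ℝ → ℝ}
    (hf : StableCone q f) :
    ∃ g, StableCone q g ∧ ∀ s, 0 < s → HasDerivAt f (-g s) s := by
  induction hf with
  | base a ha =>
    refine ⟨_, .add _ _ (.smul a ha _ (.base (a + 1) (by linarith)))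
      (.smul q hq.le _ (.base (a + 1 - q) (by linarith))), fun s hs => ?_⟩
    have h1 := Real.hasDerivAt_rpow_const (x := s) (p := -a) (.inl hs.ne')
    have h2 := (Real.hasDerivAt_rpow_const (x := s) (p := q) (.inl hs.ne')).neg.exp
    refine (h1.mul h2).congr_deriv ?_
    have e1 : s ^ (-(a + 1 - q)) = s ^ (-a) * s ^ (q - 1) := by
      rw [← Real.rpow_add hs]; ring_nf
    have e2 : -(a + 1) = -a - 1 := by ring
    simp only [Pi.neg_apply]
    rw [e1, e2]
    ring
  | add f g _ _ h1 h2 =>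
    obtain ⟨f', hf', hd⟩ := h1
    obtain ⟨g', hg', hd'⟩ := h2
    refine ⟨_, .add _ _ hf' hg', fun s hs => ((hd s hs).add (hd' s hs)).congr_deriv ?_⟩
    ring
  | smul c hc f _ h1 =>
    obtain ⟨f', hf', hd⟩ := h1
    refine ⟨_, .smul c hc _ hf', fun s hs => ((hd s hs).const_mul c).congr_deriv ?_⟩
    ring

/-- The integrals are `(-d/ds)ⁿ e^{-s^q}`, and `e^{-s^q}` is completely monotone. -/
lemma integral_pow_mul_exp_nonneg_of_laplace {q : ℝ} (hq : 0 < q) (hq1 : q < 1) {h : ℝ → ℝ}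
    (hint : ∀ s : ℝ, 0 < s → IntegrableOn (fun t => Real.exp (-(s * t)) * h t) (Ioi 0))
    (hlap : ∀ s : ℝ, 0 < s →
      ∫ t in Ioi (0 : ℝ), Real.exp (-(s * t)) * h t = Real.exp (-s ^ q))
    (n : ℕ) {s : ℝ} (hs : 0 < s) :
    0 ≤ ∫ t in Ioi (0 : ℝ), t ^ n * (Real.exp (-(s * t)) * h t) := by
  have key : ∀ n : ℕ, ∃ f, StableCone q f ∧ ∀ s, 0 < s →
      ∫ t in Ioi (0 : ℝ), t ^ n * (Real.exp (-(s * t)) * h t) = f s := by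
    intro n
    induction n with
    | zero => exact ⟨_, .base 0 le_rfl, fun s hs => by simpa using hlap s hs⟩
    | succ n ih =>
      obtain ⟨f, hf, hfe⟩ := ih
      obtain ⟨g, hg, hgd⟩ := hf.exists_hasDerivAt hq hq1
      refine ⟨g, hg, fun s hs => ?_⟩
      have h1 := hasDerivAt_integral_pow_mul_exp_neg hint n hs
      have h2 := h1.congr_of_eventuallyEq (f₁ := f)
        (by filter_upwards [Ioi_mem_nhds hs] with u hu using (hfe u hu).symm)
      exact neg_injective (h2.unique (hgd s hs))
  obtain ⟨f, hf, hfe⟩ := key n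
  rw [hfe s hs]
  exact hf.nonneg hs

/-! ### Positivity and moments of the Mainardi function -/

lemma continuousOn_stableDensity {q β : ℝ} (hq : 0 < q) (hq1 : q < 1) (hβ : Real.pi / 2 < β)
    (hβ2 : β < Real.pi) : ContinuousOn (stableDensity q β) (Ioi 0) := by
  refine ContinuousOn.congr (f := fun t => q * t ^ (-q - 1) * mainardi q (t ^ (-q))) ?_
    fun t ht => stableDensity_eq_mainardi hq hq1 hβ hβ2 ht
  have hr : ∀ p : ℝ, ContinuousOn (fun t : ℝ => t ^ p) (Ioi 0) := fun p t ht =>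
    (Real.continuousAt_rpow_const _ _ (.inl (mem_Ioi.1 ht).ne')).continuousWithinAt
  exact ((hr _).const_mul q).mul ((continuous_mainardi hq hq1).comp_continuousOn (hr _))

/-- An angle for which both `e^{tz}` and `e^{-z^q}` decay along the ray. -/
lemma exists_ray_angle {q : ℝ} (hq : 1 / 2 < q) (hq1 : q < 1) :
    ∃ β, Real.pi / 2 < β ∧ β < Real.pi ∧ q * β < Real.pi / 2 := by
  have hpi := Real.pi_pos
  have h1 : 1 < 1 / q := by rw [lt_div_iff₀ (by linarith)]; linarith
  have h2 : 1 / q < 2 := by rw [div_lt_iff₀ (by linarith)]; linarith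
  refine ⟨Real.pi / 2 * ((1 + 1 / q) / 2), by nlinarith, by nlinarith, ?_⟩
  have : q * (Real.pi / 2 * ((1 + 1 / q) / 2)) = Real.pi / 2 * ((q + 1) / 2) := by
    field_simp
  rw [this]
  nlinarith

lemma stableDensity_nonneg {q β t : ℝ} (hq : 0 < q) (hq1 : q < 1) (hβ : Real.pi / 2 < β)
    (hβ2 : β < Real.pi) (hqβ : q * β < Real.pi / 2) (ht : 0 < t) : 0 ≤ stableDensity q β t := by
  have hlap := fun s hs => integral_stableDensity_laplace (s := s) hq hβ hβ2 hqβ hs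
  exact nonneg_of_integral_pow_mul_exp_nonneg (fun s hs => (hlap s hs).1)
    (continuousOn_stableDensity hq hq1 hβ hβ2)
    (fun n s hs => integral_pow_mul_exp_nonneg_of_laplace hq hq1 (fun s hs => (hlap s hs).1)
      (fun s hs => (hlap s hs).2) n hs) ht

lemma mainardi_nonneg {q θ : ℝ} (hq : 1 / 2 < q) (hq1 : q < 1) (hθ : 0 < θ) :
    0 ≤ mainardi q θ := by
  have hq0 : 0 < q := by linarith
  obtain ⟨β, hβ, hβ2, hqβ⟩ := exists_ray_angle hq hq1
  have ht : 0 < θ ^ (-q⁻¹) := by positivity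
  have h := stableDensity_nonneg hq0 hq1 hβ hβ2 hqβ ht
  rw [stableDensity_eq_mainardi hq0 hq1 hβ hβ2 ht, ← Real.rpow_mul hθ.le (-q⁻¹) (-q), neg_mul_neg,
    inv_mul_cancel₀ hq0.ne', Real.rpow_one] at h
  exact nonneg_of_mul_nonneg_right h (by positivity)

/-- Negative moments of the stable density, from `t^{-a} = Γ(a)⁻¹ ∫ s^{a-1} e^{-st} ds`. -/
lemma integral_rpow_neg_mul_stableDensity {q β a : ℝ} (hq : 0 < q) (hq1 : q < 1)
    (hβ : Real.pi / 2 < β) (hβ2 : β < Real.pi) (hqβ : q * β < Real.pi / 2) (ha : 0 < a) :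
    IntegrableOn (fun t => t ^ (-a) * stableDensity q β t) (Ioi 0) ∧
    ∫ t in Ioi (0 : ℝ), t ^ (-a) * stableDensity q β t =
      Real.Gamma (a / q) / (q * Real.Gamma a) := by
  have hlap := fun s hs => integral_stableDensity_laplace (s := s) hq hβ hβ2 hqβ hs
  have hG := Real.Gamma_pos_of_pos ha
  set F : ℝ → ℝ → ℝ := fun s t => s ^ (a - 1) * (Real.exp (-(s * t)) * stableDensity q β t) with hF
  have hFnorm : ∀ s ∈ Ioi (0 : ℝ), ∀ t ∈ Ioi (0 : ℝ), ‖F s t‖ = F s t := by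
    intro s hs t ht
    have hs : 0 < s := hs
    have := stableDensity_nonneg hq hq1 hβ hβ2 hqβ ht
    exact Real.norm_of_nonneg (by positivity)
  have hs_int : ∀ s ∈ Ioi (0 : ℝ), ∫ t in Ioi (0 : ℝ), F s t = s ^ (a - 1) * Real.exp (-s ^ q) := by
    intro s hs
    simp only [hF]
    rw [integral_const_mul, (hlap s hs).2]
  have ht_int : ∀ t ∈ Ioi (0 : ℝ), ∫ s in Ioi (0 : ℝ), F s t =
      Real.Gamma a * (t ^ (-a) * stableDensity q β t) := by
    intro t ht
    have ht : 0 < t := ht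
    simp only [hF]
    calc ∫ s in Ioi (0 : ℝ), s ^ (a - 1) * (Real.exp (-(s * t)) * stableDensity q β t)
        = ∫ s in Ioi (0 : ℝ), (s ^ (a - 1) * Real.exp (-(t * s))) * stableDensity q β t := by
          refine integral_congr_ae (.of_forall fun s => ?_)
          simp only [mul_comm t, mul_assoc]
      _ = _ := by
          rw [integral_mul_const, Real.integral_rpow_mul_exp_neg_mul_Ioi ha ht, one_div,
            Real.inv_rpow ht.le, Real.rpow_neg ht.le]
          ring
  have hexp : IntegrableOn (fun s : ℝ => s ^ (a - 1) * Real.exp (-s ^ q)) (Ioi 0) := by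
    simpa using integrableOn_rpow_mul_exp_neg_mul_rpow (s := a - 1) (b := 1)
      (by linarith) hq one_pos
  have hprod : Integrable (Function.uncurry F)
      ((volume.restrict (Ioi 0)).prod (volume.restrict (Ioi 0))) := by
    refine (integrable_prod_iff ?_).2 ⟨?_, ?_⟩
    · rw [Measure.prod_restrict]
      refine ContinuousOn.aestronglyMeasurable ?_ (measurableSet_Ioi.prod measurableSet_Ioi)
      refine ContinuousOn.mul (fun p hp => ?_) (ContinuousOn.mul (by fun_prop) ?_)
      · have hp1 : p.1 ≠ 0 := (mem_Ioi.1 hp.1).ne'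
        exact ((Real.continuousAt_rpow_const _ _ (.inl hp1)).comp
          continuous_fst.continuousAt).continuousWithinAt
      · exact (continuousOn_stableDensity hq hq1 hβ hβ2).comp continuousOn_snd fun p hp => hp.2
    · exact (ae_restrict_iff' measurableSet_Ioi).2 (.of_forall fun s hs =>
        (hlap s hs).1.const_mul (s ^ (a - 1)))
    · refine (integrableOn_congr_fun (fun s hs => ?_) measurableSet_Ioi).1 hexp
      simp only [Function.uncurry]
      rw [setIntegral_congr_fun measurableSet_Ioi (hFnorm s hs), hs_int s hs]
  constructor
  · have h := hprod.integral_prod_right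
    simp only [Function.uncurry] at h
    have h2 := ((integrableOn_congr_fun ht_int measurableSet_Ioi).1 h).const_mul (Real.Gamma a)⁻¹
    refine h2.congr (.of_forall fun t => ?_)
    simp only
    field_simp
  · have h := integral_integral_swap hprod
    rw [setIntegral_congr_fun measurableSet_Ioi hs_int,
      setIntegral_congr_fun measurableSet_Ioi ht_int, integral_const_mul,
      integral_rpow_mul_exp_neg_rpow hq (by linarith), sub_add_cancel] at h
    rw [eq_div_iff (by positivity)]
    field_simp at h
    linarith

/-- The substitution `θ = t^{-q}` turns the second moment of `M_q` into the moment of order `-2q` of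
the stable density. -/
lemma mainardi_second_moment {q : ℝ} (hq : 1 / 2 < q) (hq1 : q < 1) :
    IntegrableOn (fun θ => θ ^ 2 * mainardi q θ) (Ioi 0) ∧
    ∫ θ in Ioi (0 : ℝ), θ ^ 2 * mainardi q θ = 2 / Real.Gamma (2 * q + 1) := by
  have hq0 : 0 < q := by linarith
  obtain ⟨β, hβ, hβ2, hqβ⟩ := exists_ray_angle hq hq1
  obtain ⟨h1, h2⟩ := integral_rpow_neg_mul_stableDensity (a := 2 * q) hq0 hq1 hβ hβ2 hqβ
    (by linarith)
  have hcongr : ∀ t ∈ Ioi (0 : ℝ), t ^ (-(2 * q)) * stableDensity q β t =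
      (|-q| * t ^ (-q - 1)) • ((t ^ (-q)) ^ 2 * mainardi q (t ^ (-q))) := by
    intro t ht
    have ht : 0 < t := ht
    rw [stableDensity_eq_mainardi hq0 hq1 hβ hβ2 ht, abs_neg, abs_of_pos hq0,
      ← Real.rpow_natCast (t ^ (-q)), ← Real.rpow_mul ht.le, smul_eq_mul]
    push_cast
    ring_nf
  have hneg : -q ≠ 0 := neg_ne_zero.2 hq0.ne'
  constructor
  · exact (integrableOn_Ioi_comp_rpow_iff (fun θ => θ ^ 2 * mainardi q θ) hneg).1
      ((integrableOn_congr_fun hcongr measurableSet_Ioi).1 h1)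
  · rw [← integral_comp_rpow_Ioi (fun θ => θ ^ 2 * mainardi q θ) hneg,
      ← setIntegral_congr_fun measurableSet_Ioi hcongr, h2, mul_div_cancel_right₀ _ hq0.ne',
      Real.Gamma_two, Real.Gamma_add_one (by positivity)]
    have := Real.Gamma_pos_of_pos (by linarith : 0 < 2 * q)
    field_simp

/-- Near `0` by continuity, near infinity by comparison with the second moment. -/
lemma integrableOn_mainardi {q : ℝ} (hq : 1 / 2 < q) (hq1 : q < 1) :
    IntegrableOn (mainardi q) (Ioi 0) := by
  have hc := continuous_mainardi (by linarith) hq1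
  rw [← Ioc_union_Ioi_eq_Ioi zero_le_one]
  refine IntegrableOn.union ?_ ?_
  · exact (hc.continuousOn.integrableOn_Icc (a := 0) (b := 1)).mono_set Ioc_subset_Icc_self
  · refine ((mainardi_second_moment hq hq1).1.mono_set (Ioi_subset_Ioi zero_le_one)).mono'
      hc.aestronglyMeasurable ?_
    refine (ae_restrict_iff' measurableSet_Ioi).2 (.of_forall fun θ hθ => ?_)
    have hθ : 1 < θ := hθ
    have h := mainardi_nonneg hq hq1 (by linarith : 0 < θ)
    rw [Real.norm_of_nonneg h]
    nlinarith [mul_nonneg (by nlinarith : 0 ≤ θ ^ 2 - 1) h]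

/-! ### Averages of the cosine and sine families -/

/-- The measure `M_q(θ) dθ` on `(0, ∞)`, which is the Dirac mass at `1` for `q = 1`. The density is
truncated to its positive part, which changes nothing as `M_q ≥ 0` by `mainardi_nonneg`. -/
def mainardiMeasure (q : ℝ) : Measure ℝ :=
  if q = 1 then Measure.dirac 1
  else (volume.restrict (Ioi 0)).withDensity fun θ => ((mainardi q θ).toNNReal : ENNReal)

lemma measurable_toNNReal_mainardi {q : ℝ} (hq : 0 < q) (hq1 : q < 1) :
    Measurable fun θ => (mainardi q θ).toNNReal :=
  (continuous_mainardi hq hq1).measurable.real_toNNReal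

/-- A family of additive maps that is strongly continuous and locally bounded is jointly
continuous. -/
lemma continuous_uncurry_of_bound {Y : Type*} [NormedAddCommGroup Y]
    {F : ℝ → Y → Y} {k : ℝ → ℝ} (hk : Continuous k)
    (hsub : ∀ t x y, F t (x - y) = F t x - F t y) (hb : ∀ t x, ‖F t x‖ ≤ k t * ‖x‖)
    (hc : ∀ x, Continuous fun t => F t x) : Continuous fun p : ℝ × Y => F p.1 p.2 := by
  refine continuous_iff_continuousAt.2 fun ⟨t₀, x₀⟩ => ?_
  have h1 : Tendsto (fun p : ℝ × Y => F p.1 (p.2 - x₀)) (𝓝 (t₀, x₀)) (𝓝 0) := by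
    refine squeeze_zero_norm (fun p => hb _ _) ?_
    have : Continuous fun p : ℝ × Y => k p.1 * ‖p.2 - x₀‖ := by fun_prop
    simpa using this.tendsto (t₀, x₀)
  have h2 : Tendsto (fun p : ℝ × Y => F p.1 x₀) (𝓝 (t₀, x₀)) (𝓝 (F t₀ x₀)) :=
    ((hc x₀).comp continuous_fst).tendsto (t₀, x₀)
  have h3 := h1.add h2
  rw [zero_add] at h3
  refine h3.congr fun p => ?_
  rw [hsub, sub_add_cancel]

variable {X : Type*} [NormedAddCommGroup X] [NormedSpace ℝ X]

lemma toNNReal_mainardi_smul {q θ : ℝ} (hq : 1 / 2 < q) (hq1 : q < 1) (hθ : θ ∈ Ioi (0 : ℝ))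
    (x : X) : (mainardi q θ).toNNReal • x = mainardi q θ • x := by
  rw [NNReal.smul_def, Real.coe_toNNReal _ (mainardi_nonneg hq hq1 hθ)]

lemma integrable_mainardiMeasure_iff {q : ℝ} (hq : 1 / 2 < q) (hq1 : q < 1) (g : ℝ → X) :
    Integrable g (mainardiMeasure q) ↔ IntegrableOn (fun θ => mainardi q θ • g θ) (Ioi 0) := by
  rw [mainardiMeasure, if_neg hq1.ne, integrable_withDensity_iff_integrable_smul
    (measurable_toNNReal_mainardi (by linarith) hq1)]
  exact integrableOn_congr_fun (fun θ hθ => toNNReal_mainardi_smul hq hq1 hθ _) measurableSet_Ioi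

lemma mainardiIntegral_eq [CompleteSpace X] {q : ℝ} (hq : 1 / 2 < q) (hq1 : q ≤ 1) (g : ℝ → X) :
    mainardiIntegral q g = ∫ θ, g θ ∂(mainardiMeasure q) := by
  rcases hq1.eq_or_lt with rfl | hq1
  · simp [mainardiIntegral, mainardiMeasure]
  · rw [mainardiIntegral, mainardiMeasure, if_neg hq1.ne, if_neg hq1.ne,
      integral_withDensity_eq_integral_smul (measurable_toNNReal_mainardi (by linarith) hq1)]
    exact (setIntegral_congr_fun measurableSet_Ioi
      fun θ hθ => toNNReal_mainardi_smul hq hq1 hθ _).symm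

lemma mainardiIntegrable_of_integrable {q : ℝ} (hq : 1 / 2 < q) (hq1 : q ≤ 1) {g : ℝ → X}
    (hg : Integrable g (mainardiMeasure q)) : MainardiIntegrable q g := fun hne =>
  (integrable_mainardiMeasure_iff hq (lt_of_le_of_ne hq1 hne) g).1 hg

lemma isFiniteMeasure_mainardiMeasure {q : ℝ} (hq : 1 / 2 < q) (hq1 : q ≤ 1) :
    IsFiniteMeasure (mainardiMeasure q) := by
  rcases hq1.eq_or_lt with rfl | hq1
  · rw [mainardiMeasure, if_pos rfl]; infer_instance
  · have h : Integrable (fun _ => (1 : ℝ)) (mainardiMeasure q) := by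
      rw [integrable_mainardiMeasure_iff hq hq1]
      simpa using integrableOn_mainardi hq hq1
    exact (integrable_const_iff_isFiniteMeasure one_ne_zero).1 h

lemma mainardiMeasure_second_moment {q : ℝ} (hq : 1 / 2 < q) (hq1 : q ≤ 1) :
    Integrable (fun θ : ℝ => θ ^ 2) (mainardiMeasure q) ∧
    ∫ θ, θ ^ 2 ∂(mainardiMeasure q) = 2 / Real.Gamma (2 * q + 1) := by
  rcases hq1.eq_or_lt with rfl | hq1
  · have h3 : Real.Gamma (2 * 1 + 1) = 2 := by
      rw [Real.Gamma_add_one (by norm_num), mul_one, Real.Gamma_two]; norm_num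
    rw [mainardiMeasure, if_pos rfl, h3]
    refine ⟨?_, by simp⟩
    exact integrable_dirac (by simp)
  · obtain ⟨h1, h2⟩ := mainardi_second_moment hq hq1
    refine ⟨(integrable_mainardiMeasure_iff hq hq1 _).2 (h1.congr (.of_forall fun θ => ?_)), ?_⟩
    · simp [mul_comm]
    · rw [← mainardiIntegral_eq hq hq1.le, mainardiIntegral, if_neg hq1.ne, ← h2]
      simp [mul_comm]

/-- The hypotheses on the order, the change of time and the cosine family under which the
operators in the mild-solution formula are studied. -/
structure FormulaData (q T K : ℝ) (ψ : ℝ → ℝ) (C : ℝ → X →L[ℝ] X) : Prop where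
  half_lt : 1 / 2 < q
  le_one : q ≤ 1
  contDiffOn : ContDiffOn ℝ 1 ψ (Icc 0 T)
  strictMonoOn : StrictMonoOn ψ (Icc 0 T)
  strong_continuous : ∀ x : X, Continuous fun t : ℝ => C t x
  norm_le : ∀ t : ℝ, ‖C t‖ ≤ K
  time_pos : 0 < T

namespace FormulaData
variable {q T K : ℝ} {ψ : ℝ → ℝ} {C : ℝ → X →L[ℝ] X}

lemma pos (D : FormulaData q T K ψ C) : 0 < q := by linarith [D.half_lt]

lemma K_nonneg (D : FormulaData q T K ψ C) : 0 ≤ K := (norm_nonneg _).trans (D.norm_le 0)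

lemma norm_apply_le (D : FormulaData q T K ψ C) (t : ℝ) (x : X) : ‖C t x‖ ≤ K * ‖x‖ :=
  (C t).le_of_opNorm_le (D.norm_le t) x

lemma norm_sine_le (D : FormulaData q T K ψ C) (t : ℝ) (x : X) :
    ‖sine C t x‖ ≤ K * ‖x‖ * |t| := by
  simpa [sine] using intervalIntegral.norm_integral_le_of_norm_le_const (a := 0) (b := t)
    fun s _ => D.norm_apply_le s x

lemma sine_sub (D : FormulaData q T K ψ C) (t : ℝ) (x y : X) :
    sine C t (x - y) = sine C t x - sine C t y := by
  simp only [sine, map_sub]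
  exact intervalIntegral.integral_sub ((D.strong_continuous x).intervalIntegrable _ _)
    ((D.strong_continuous y).intervalIntegrable _ _)

lemma continuous_sine (D : FormulaData q T K ψ C) (x : X) : Continuous fun t => sine C t x :=
  intervalIntegral.continuous_primitive
    (fun _ _ => (D.strong_continuous x).intervalIntegrable _ _) 0

lemma integrable_cosine (D : FormulaData q T K ψ C) (τ : ℝ) (x : X) :
    Integrable (fun θ => C (τ * θ) x) (mainardiMeasure q) := by
  have := isFiniteMeasure_mainardiMeasure D.half_lt D.le_one
  refine (integrable_const (K * ‖x‖)).mono' ?_ (.of_forall fun θ => D.norm_apply_le _ x)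
  exact ((D.strong_continuous x).comp (continuous_const_mul τ)).aestronglyMeasurable

lemma norm_smul_sine_le (D : FormulaData q T K ψ C) (τ θ : ℝ) (x : X) :
    ‖(q * θ) • sine C (τ * θ) x‖ ≤ (q * K * |τ| * ‖x‖) * θ ^ 2 := by
  rw [norm_smul, norm_mul, Real.norm_of_nonneg D.pos.le, Real.norm_eq_abs]
  calc q * |θ| * ‖sine C (τ * θ) x‖ ≤ q * |θ| * (K * ‖x‖ * |τ * θ|) := by
        have := D.pos
        gcongr
        exact D.norm_sine_le _ x
    _ = _ := by rw [abs_mul, ← sq_abs θ]; ring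

lemma aestronglyMeasurable_sine (D : FormulaData q T K ψ C) (τ : ℝ) (x : X) :
    AEStronglyMeasurable (fun θ : ℝ => (q * θ) • sine C (τ * θ) x) (mainardiMeasure q) := by
  refine Continuous.aestronglyMeasurable ?_
  have := (D.continuous_sine x).comp (continuous_const_mul τ)
  exact (continuous_const_mul q).smul this

lemma integrable_sine (D : FormulaData q T K ψ C) (τ : ℝ) (x : X) :
    Integrable (fun θ : ℝ => (q * θ) • sine C (τ * θ) x) (mainardiMeasure q) :=
  ((mainardiMeasure_second_moment D.half_lt D.le_one).1.const_mul _).mono'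
    (D.aestronglyMeasurable_sine τ x) (.of_forall fun θ => D.norm_smul_sine_le τ θ x)

end FormulaData

/-- The average `∫ C(τθ)x M_q(θ) dθ`. -/
def cosineAverage (q : ℝ) (C : ℝ → X →L[ℝ] X) (τ : ℝ) (x : X) : X :=
  ∫ θ, C (τ * θ) x ∂(mainardiMeasure q)

/-- The average `∫ qθ S(τθ)x M_q(θ) dθ`. -/
def sineAverage (q : ℝ) (C : ℝ → X →L[ℝ] X) (τ : ℝ) (x : X) : X :=
  ∫ θ, (q * θ) • sine C (τ * θ) x ∂(mainardiMeasure q)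

namespace FormulaData
variable {q T K : ℝ} {ψ : ℝ → ℝ} {C : ℝ → X →L[ℝ] X}

lemma continuous_cosineAverage (D : FormulaData q T K ψ C) (x : X) :
    Continuous fun τ => cosineAverage q C τ x := by
  have := isFiniteMeasure_mainardiMeasure D.half_lt D.le_one
  refine continuous_of_dominated (bound := fun _ => K * ‖x‖)
    (fun τ => (D.integrable_cosine τ x).aestronglyMeasurable)
    (fun τ => .of_forall fun θ => D.norm_apply_le _ x) (integrable_const _)
    (.of_forall fun θ => (D.strong_continuous x).comp (continuous_mul_const θ))

lemma sineAverage_sub (D : FormulaData q T K ψ C) (τ : ℝ) (x y : X) :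
    sineAverage q C τ (x - y) = sineAverage q C τ x - sineAverage q C τ y := by
  simp only [sineAverage, D.sine_sub, smul_sub]
  exact integral_sub (D.integrable_sine τ x) (D.integrable_sine τ y)

/-- The constant comes from the second moment `2 / Γ(2q+1) = 1 / (q Γ(2q))`, which
equals the second absolute moment because `M_q ≥ 0`. -/
lemma norm_sineAverage_le (D : FormulaData q T K ψ C) (τ : ℝ) (x : X) :
    ‖sineAverage q C τ x‖ ≤ K / Real.Gamma (2 * q) * |τ| * ‖x‖ := by
  obtain ⟨h1, h2⟩ := mainardiMeasure_second_moment D.half_lt D.le_one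
  have hq := D.pos
  have hG := Real.Gamma_pos_of_pos (by positivity : 0 < 2 * q)
  calc ‖sineAverage q C τ x‖
      ≤ ∫ θ, (q * K * |τ| * ‖x‖) * θ ^ 2 ∂(mainardiMeasure q) :=
        norm_integral_le_of_norm_le (h1.const_mul _)
          (.of_forall fun θ => D.norm_smul_sine_le τ θ x)
    _ = _ := by
        rw [integral_const_mul, h2, Real.Gamma_add_one (by positivity)]
        field_simp

lemma continuous_sineAverage_left (D : FormulaData q T K ψ C) (x : X) :
    Continuous fun τ => sineAverage q C τ x := by
  obtain ⟨h1, -⟩ := mainardiMeasure_second_moment D.half_lt D.le_one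
  refine continuous_iff_continuousAt.2 fun τ₀ => ?_
  refine continuousAt_of_dominated (bound := fun θ => (q * K * (|τ₀| + 1) * ‖x‖) * θ ^ 2)
    (.of_forall fun τ => D.aestronglyMeasurable_sine τ x) ?_ (h1.const_mul _)
    (.of_forall fun θ => ?_)
  · have : ∀ᶠ τ in 𝓝 τ₀, |τ| < |τ₀| + 1 :=
      continuous_abs.continuousAt.eventually (gt_mem_nhds (by linarith))
    filter_upwards [this] with τ hτ
    refine .of_forall fun θ => (D.norm_smul_sine_le τ θ x).trans ?_
    have := D.pos
    have := D.K_nonneg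
    gcongr
  · have := (D.continuous_sine x).comp (continuous_mul_const θ)
    exact (this.const_smul (q * θ)).continuousAt

lemma continuous_sineAverage (D : FormulaData q T K ψ C) :
    Continuous fun p : ℝ × X => sineAverage q C p.1 p.2 :=
  continuous_uncurry_of_bound (k := fun τ => K / Real.Gamma (2 * q) * |τ|) (by fun_prop)
    D.sineAverage_sub D.norm_sineAverage_le D.continuous_sineAverage_left

end FormulaData

/-! ### The Duhamel term and the fixed point -/

/-- The kernel `(ψ(t)-ψ(s))^{q-1} ψ'(s) P_q^ψ(t,s)` of the Duhamel term, applied to `x`. -/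
def memoryKernel (q : ℝ) (C : ℝ → X →L[ℝ] X) (T : ℝ) (ψ : ℝ → ℝ) (t s : ℝ) (x : X) : X :=
  ((ψ t - ψ s) ^ (q - 1) * dpsi T ψ s) • sineAverage q C ((ψ t - ψ s) ^ q) x

namespace FormulaData
variable {q T K : ℝ} {ψ : ℝ → ℝ} {C : ℝ → X →L[ℝ] X}

lemma continuousOn_dpsi (D : FormulaData q T K ψ C) : ContinuousOn (dpsi T ψ) (Icc 0 T) :=
  D.contDiffOn.continuousOn_derivWithin (uniqueDiffOn_Icc D.time_pos) le_rfl

lemma dpsi_nonneg (D : FormulaData q T K ψ C) (s : ℝ) : 0 ≤ dpsi T ψ s :=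
  D.strictMonoOn.monotoneOn.derivWithin_nonneg

lemma hasDerivAt_dpsi (D : FormulaData q T K ψ C) {s : ℝ} (hs : s ∈ Ioo 0 T) :
    HasDerivAt ψ (dpsi T ψ s) s :=
  ((D.contDiffOn.differentiableOn one_ne_zero) s (Ioo_subset_Icc_self hs)).hasDerivWithinAt
    |>.hasDerivAt (Icc_mem_nhds hs.1 hs.2)

lemma psi_sub_nonneg (D : FormulaData q T K ψ C) {s t : ℝ} (hs : 0 ≤ s) (hst : s ≤ t) (ht : t ≤ T) :
    0 ≤ ψ t - ψ s :=
  sub_nonneg.2 (D.strictMonoOn.monotoneOn ⟨hs, hst.trans ht⟩ ⟨hs.trans hst, ht⟩ hst)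

lemma integral_weight (D : FormulaData q T K ψ C) {t : ℝ} (ht : t ∈ Icc 0 T) :
    IntervalIntegrable (fun s => (ψ t - ψ s) ^ (2 * q - 1) * dpsi T ψ s) volume 0 t ∧
    ∫ s in (0 : ℝ)..t, (ψ t - ψ s) ^ (2 * q - 1) * dpsi T ψ s =
      (ψ t - ψ 0) ^ (2 * q) / (2 * q) := by
  have hq := D.half_lt
  have hsub : Icc 0 t ⊆ Icc 0 T := Icc_subset_Icc_right ht.2
  have hψ : ContinuousOn ψ (Icc 0 t) := D.contDiffOn.continuousOn.mono hsub
  have hint : IntervalIntegrable (fun s => (ψ t - ψ s) ^ (2 * q - 1) * dpsi T ψ s) volume 0 t := by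
    refine ContinuousOn.intervalIntegrable_of_Icc ht.1 ?_
    exact ((Real.continuous_rpow_const (by linarith)).comp_continuousOn
      (continuousOn_const.sub hψ)).mul (D.continuousOn_dpsi.mono hsub)
  refine ⟨hint, ?_⟩
  rw [intervalIntegral.integral_eq_sub_of_hasDerivAt_of_le
    (f := fun s => -((ψ t - ψ s) ^ (2 * q) / (2 * q))) ht.1 ?_ ?_ hint]
  · rw [sub_self, Real.zero_rpow (by linarith)]
    ring
  · exact (((Real.continuous_rpow_const (by linarith)).comp_continuousOn
      (continuousOn_const.sub hψ)).div_const _).neg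
  · intro s hs
    have h1 := (D.hasDerivAt_dpsi ⟨hs.1, hs.2.trans_le ht.2⟩).const_sub (ψ t)
    have h2 : 0 < ψ t - ψ s :=
      sub_pos.2 (D.strictMonoOn ⟨hs.1.le, hs.2.le.trans ht.2⟩ ht hs.2)
    refine ((h1.rpow_const (p := 2 * q) (.inl h2.ne')).div_const (2 * q)).neg.congr_deriv ?_
    have : q ≠ 0 := by linarith
    field_simp

lemma memoryKernel_sub (D : FormulaData q T K ψ C) (t s : ℝ) (x y : X) :
    memoryKernel q C T ψ t s (x - y) = memoryKernel q C T ψ t s x - memoryKernel q C T ψ t s y := by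
  rw [memoryKernel, D.sineAverage_sub, smul_sub]; rfl

/-- At `s = t` both sides vanish, also for `q < 1`, where `0 ^ (q - 1) = 0` in Lean. -/
lemma norm_memoryKernel_le (D : FormulaData q T K ψ C) {s t : ℝ} (hs : 0 ≤ s) (hst : s ≤ t)
    (ht : t ≤ T) (x : X) :
    ‖memoryKernel q C T ψ t s x‖ ≤
      K / Real.Gamma (2 * q) * ((ψ t - ψ s) ^ (2 * q - 1) * dpsi T ψ s) * ‖x‖ := by
  have hu := D.psi_sub_nonneg hs hst ht
  have hd := D.dpsi_nonneg s
  have hq := D.half_lt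
  have hpow : (ψ t - ψ s) ^ (q - 1) * (ψ t - ψ s) ^ q = (ψ t - ψ s) ^ (2 * q - 1) := by
    rcases hu.eq_or_lt with h0 | h0
    · rw [← h0, Real.zero_rpow (by linarith : q ≠ 0), mul_zero, Real.zero_rpow (by linarith)]
    · rw [← Real.rpow_add h0]; ring_nf
  rw [memoryKernel, norm_smul, norm_mul, Real.norm_of_nonneg hd,
    Real.norm_of_nonneg (Real.rpow_nonneg hu _)]
  calc (ψ t - ψ s) ^ (q - 1) * dpsi T ψ s * ‖sineAverage q C ((ψ t - ψ s) ^ q) x‖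
      ≤ (ψ t - ψ s) ^ (q - 1) * dpsi T ψ s *
          (K / Real.Gamma (2 * q) * |(ψ t - ψ s) ^ q| * ‖x‖) := by
        gcongr
        exact D.norm_sineAverage_le _ x
    _ = _ := by
        rw [abs_of_nonneg (Real.rpow_nonneg hu _), ← hpow]
        ring

lemma continuousOn_memoryKernel (D : FormulaData q T K ψ C) {F : ℝ → X}
    (hF : ContinuousOn F (Icc 0 T)) :
    ContinuousOn (fun p : ℝ × ℝ => memoryKernel q C T ψ p.1 p.2 (F p.2))
      {p | 0 ≤ p.2 ∧ p.2 < p.1 ∧ p.1 ≤ T} := by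
  set S : Set (ℝ × ℝ) := {p | 0 ≤ p.2 ∧ p.2 < p.1 ∧ p.1 ≤ T}
  have h1 : MapsTo Prod.fst S (Icc 0 T) := fun p hp => ⟨hp.1.trans hp.2.1.le, hp.2.2⟩
  have h2 : MapsTo Prod.snd S (Icc 0 T) := fun p hp => ⟨hp.1, hp.2.1.le.trans hp.2.2⟩
  have hψ := D.contDiffOn.continuousOn
  have hdiff : ContinuousOn (fun p : ℝ × ℝ => ψ p.1 - ψ p.2) S :=
    (hψ.comp continuousOn_fst h1).sub (hψ.comp continuousOn_snd h2)
  have hpos : ∀ p ∈ S, ψ p.1 - ψ p.2 ≠ 0 := fun p hp =>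
    (sub_pos.2 (D.strictMonoOn (h2 hp) (h1 hp) hp.2.1)).ne'
  refine ContinuousOn.smul (ContinuousOn.mul ?_ (D.continuousOn_dpsi.comp continuousOn_snd h2)) ?_
  · exact hdiff.rpow_const fun p hp => .inl (hpos p hp)
  · exact D.continuous_sineAverage.comp_continuousOn
      ((hdiff.rpow_const fun p hp => .inl (hpos p hp)).prodMk (hF.comp continuousOn_snd h2))

lemma continuousOn_memoryKernel_snd (D : FormulaData q T K ψ C) {F : ℝ → X}
    (hF : ContinuousOn F (Icc 0 T)) {t : ℝ} (ht : t ≤ T) :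
    ContinuousOn (fun s => memoryKernel q C T ψ t s (F s)) (Ioo 0 t) :=
  (D.continuousOn_memoryKernel hF).comp (f := fun s => (t, s)) (by fun_prop)
    fun _ hs => ⟨hs.1.le, hs.2, ht⟩

lemma intervalIntegrable_memoryKernel (D : FormulaData q T K ψ C) {F : ℝ → X}
    (hF : ContinuousOn F (Icc 0 T)) {t : ℝ} (ht : t ∈ Icc 0 T) :
    IntervalIntegrable (fun s => memoryKernel q C T ψ t s (F s)) volume 0 t := by
  obtain ⟨B, hB⟩ := isCompact_Icc.exists_bound_of_continuousOn hF
  have hw := (((D.integral_weight ht).1).const_mul (K / Real.Gamma (2 * q))).mul_const B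
  rw [intervalIntegrable_iff_integrableOn_Ioo_of_le ht.1] at hw ⊢
  refine hw.mono' ((D.continuousOn_memoryKernel_snd hF ht.2).aestronglyMeasurable
    measurableSet_Ioo) ((ae_restrict_iff' measurableSet_Ioo).2 (.of_forall fun s hs => ?_))
  refine (D.norm_memoryKernel_le hs.1.le hs.2.le ht.2 _).trans ?_
  have hK := D.K_nonneg
  have hd := D.dpsi_nonneg s
  have hG := Real.Gamma_pos_of_pos (by linarith [D.half_lt] : 0 < 2 * q)
  have hu := Real.rpow_nonneg (D.psi_sub_nonneg hs.1.le hs.2.le ht.2) (2 * q - 1)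
  gcongr
  exact hB s ⟨hs.1.le, hs.2.le.trans ht.2⟩

/-- Dominated convergence over the fixed interval `(0, T)`, with the integrand cut off at `s = t`;
the cut moves through `s = t₀` only, a null set. -/
lemma continuousOn_integral_memoryKernel (D : FormulaData q T K ψ C) {F : ℝ → X}
    (hF : ContinuousOn F (Icc 0 T)) :
    ContinuousOn (fun t => ∫ s in (0 : ℝ)..t, memoryKernel q C T ψ t s (F s)) (Icc 0 T) := by
  have hcut : ∀ t ∈ Icc 0 T, ∫ s in (0 : ℝ)..t, memoryKernel q C T ψ t s (F s) =
      ∫ s in Ioo 0 T, (Iio t).indicator (fun s => memoryKernel q C T ψ t s (F s)) s := by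
    intro t ht
    rw [intervalIntegral.integral_of_le ht.1, integral_Ioc_eq_integral_Ioo,
      setIntegral_indicator measurableSet_Iio, Ioo_inter_Iio, min_eq_right ht.2]
  refine ContinuousOn.congr ?_ hcut
  intro t₀ ht₀
  obtain ⟨B, hB⟩ := isCompact_Icc.exists_bound_of_continuousOn hF
  have hT := D.time_pos
  have hK := D.K_nonneg
  have hq := D.half_lt
  have hG := Real.Gamma_pos_of_pos (by linarith : 0 < 2 * q)
  have hB0 : 0 ≤ B := (norm_nonneg _).trans (hB 0 ⟨le_rfl, hT.le⟩)
  have hu0 := Real.rpow_nonneg (D.psi_sub_nonneg le_rfl hT.le le_rfl) (2 * q - 1)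
  refine continuousWithinAt_of_dominated
    (bound := fun s => K / Real.Gamma (2 * q) * ((ψ T - ψ 0) ^ (2 * q - 1) * dpsi T ψ s) * B)
    ?_ ?_ ?_ ?_
  · filter_upwards [self_mem_nhdsWithin] with t ht
    rw [aestronglyMeasurable_indicator_iff measurableSet_Iio, Measure.restrict_restrict
      measurableSet_Iio, inter_comm, Ioo_inter_Iio, min_eq_right ht.2]
    exact (D.continuousOn_memoryKernel_snd hF ht.2).aestronglyMeasurable measurableSet_Ioo
  · filter_upwards [self_mem_nhdsWithin] with t ht
    refine (ae_restrict_iff' measurableSet_Ioo).2 (.of_forall fun s hs => ?_)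
    have hd := D.dpsi_nonneg s
    by_cases hst : s ∈ Iio t
    · rw [indicator_of_mem hst]
      have hst : s < t := hst
      refine (D.norm_memoryKernel_le hs.1.le hst.le ht.2 _).trans ?_
      have hu := D.psi_sub_nonneg hs.1.le hst.le ht.2
      have hmono : ψ t - ψ s ≤ ψ T - ψ 0 := by
        have h1 := D.psi_sub_nonneg le_rfl hs.1.le hs.2.le
        have h2 := D.psi_sub_nonneg ht.1 ht.2 le_rfl
        linarith
      gcongr
      · linarith
      · exact hB s ⟨hs.1.le, hs.2.le⟩
    · rw [indicator_of_notMem hst, norm_zero]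
      positivity
  · have : IntegrableOn (dpsi T ψ) (Ioo 0 T) :=
      (D.continuousOn_dpsi.integrableOn_Icc).mono_set Ioo_subset_Icc_self
    exact ((this.const_mul _).const_mul _).mul_const B
  · have hne : ∀ᵐ s : ℝ, s ≠ t₀ := by simp [ae_iff, measure_singleton]
    refine (ae_restrict_iff' measurableSet_Ioo).2 ?_
    filter_upwards [hne] with s hs hsT
    rcases lt_or_gt_of_ne hs with h | h
    · have hc : ContinuousWithinAt (fun t => memoryKernel q C T ψ t s (F s)) (Ioc s T) t₀ :=
        ((D.continuousOn_memoryKernel hF).comp (f := fun t => (t, s)) (by fun_prop)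
          fun t ht => ⟨hsT.1.le, ht.1, ht.2⟩) t₀ ⟨h, ht₀.2⟩
      have hmem : Ioc s T ∈ 𝓝[Icc 0 T] t₀ := by
        filter_upwards [self_mem_nhdsWithin,
          mem_nhdsWithin_of_mem_nhds (Ioi_mem_nhds h)] with t h1 h2
        exact ⟨h2, h1.2⟩
      refine (hc.mono_of_mem_nhdsWithin hmem).congr_of_eventuallyEq ?_ ?_
      · filter_upwards [hmem] with t h1
        exact indicator_of_mem (show s ∈ Iio t from h1.1) _
      · exact indicator_of_mem (show s ∈ Iio t₀ from h) _
    · refine (continuousWithinAt_const (b := (0 : X))).congr_of_eventuallyEq ?_ ?_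
      · filter_upwards [mem_nhdsWithin_of_mem_nhds (Iio_mem_nhds h)] with t h1
        exact indicator_of_notMem (notMem_Iio.2 (le_of_lt (mem_Iio.1 h1))) _
      · exact indicator_of_notMem (notMem_Iio.2 (le_of_lt h)) _

lemma norm_integral_memoryKernel_le (D : FormulaData q T K ψ C) {F : ℝ → X} {B t : ℝ}
    (ht : t ∈ Icc 0 T) (hB : ∀ s ∈ Icc 0 T, ‖F s‖ ≤ B) :
    ‖∫ s in (0 : ℝ)..t, memoryKernel q C T ψ t s (F s)‖ ≤
      K * (ψ T - ψ 0) ^ (2 * q) / Real.Gamma (2 * q + 1) * B := by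
  obtain ⟨h1, h2⟩ := D.integral_weight ht
  have hK := D.K_nonneg
  have hq := D.half_lt
  have hG := Real.Gamma_pos_of_pos (by linarith : 0 < 2 * q)
  have hB0 : 0 ≤ B := (norm_nonneg _).trans (hB 0 ⟨le_rfl, D.time_pos.le⟩)
  have hle : ‖∫ s in (0 : ℝ)..t, memoryKernel q C T ψ t s (F s)‖ ≤
      ∫ s in (0 : ℝ)..t, K / Real.Gamma (2 * q) * ((ψ t - ψ s) ^ (2 * q - 1) * dpsi T ψ s) * B := by
    refine intervalIntegral.norm_integral_le_of_norm_le ht.1 (.of_forall fun s hs => ?_)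
      ((h1.const_mul _).mul_const B)
    refine (D.norm_memoryKernel_le hs.1.le hs.2 ht.2 _).trans ?_
    have hd := D.dpsi_nonneg s
    have hu := Real.rpow_nonneg (D.psi_sub_nonneg hs.1.le hs.2 ht.2) (2 * q - 1)
    gcongr
    exact hB s ⟨hs.1.le, hs.2.trans ht.2⟩
  refine hle.trans ?_
  rw [intervalIntegral.integral_mul_const, intervalIntegral.integral_const_mul, h2]
  have hmono : (ψ t - ψ 0) ^ (2 * q) ≤ (ψ T - ψ 0) ^ (2 * q) := by
    have h3 := D.psi_sub_nonneg ht.1 ht.2 le_rfl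
    have h4 := D.psi_sub_nonneg le_rfl ht.1 ht.2
    exact Real.rpow_le_rpow h4 (by linarith) (by linarith)
  rw [Real.Gamma_add_one (by linarith)]
  calc K / Real.Gamma (2 * q) * ((ψ t - ψ 0) ^ (2 * q) / (2 * q)) * B
      ≤ K / Real.Gamma (2 * q) * ((ψ T - ψ 0) ^ (2 * q) / (2 * q)) * B := by gcongr
    _ = _ := by
      field_simp

variable [CompleteSpace X]

lemma opC_eq (D : FormulaData q T K ψ C) (t : ℝ) (x : X) :
    opC q C ψ t x = cosineAverage q C ((ψ t - ψ 0) ^ q) x :=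
  mainardiIntegral_eq D.half_lt D.le_one _

lemma duhamelIntegrand_eq (D : FormulaData q T K ψ C) (f : ℝ → X → X) (Θ : ℝ → X) (t s : ℝ) :
    duhamelIntegrand q C T ψ f Θ t s = memoryKernel q C T ψ t s (f s (Θ s)) := by
  rw [duhamelIntegrand, opP, mainardiIntegral_eq D.half_lt D.le_one]; rfl

lemma continuousOn_opC (D : FormulaData q T K ψ C) (x : X) :
    ContinuousOn (fun t => opC q C ψ t x) (Icc 0 T) := by
  simp only [D.opC_eq]
  exact (D.continuous_cosineAverage x).comp_continuousOn
    ((Real.continuous_rpow_const D.pos.le).comp_continuousOn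
      (D.contDiffOn.continuousOn.sub continuousOn_const))

lemma continuousOn_opR_integrand (D : FormulaData q T K ψ C) (x : X) :
    ContinuousOn (fun s => (dpsi T ψ s / dpsi T ψ 0) • opC q C ψ s x) (Icc 0 T) :=
  (D.continuousOn_dpsi.div_const _).smul (D.continuousOn_opC x)

lemma continuousOn_opR (D : FormulaData q T K ψ C) (x : X) :
    ContinuousOn (fun t => opR q C T ψ t x) (Icc 0 T) := by
  have := intervalIntegral.continuousOn_primitive_interval (a := 0) (b := T) (μ := volume)
    (f := fun s => (dpsi T ψ s / dpsi T ψ 0) • opC q C ψ s x)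
    (by rw [uIcc_of_le D.time_pos.le]; exact (D.continuousOn_opR_integrand x).integrableOn_Icc)
  rwa [uIcc_of_le D.time_pos.le] at this

lemma formulaWellDefined (D : FormulaData q T K ψ C) (hT : 0 < T) {f : ℝ → X → X}
    (hf : ContinuousOn (Function.uncurry f) (Icc 0 T ×ˢ univ)) :
    FormulaWellDefined q C hT ψ f where
  opC_integrable x t _ :=
    mainardiIntegrable_of_integrable D.half_lt D.le_one (D.integrable_cosine _ x)
  opR_integrable x t ht := ((D.continuousOn_opR_integrand x).mono
    (Icc_subset_Icc_right ht.2)).intervalIntegrable_of_Icc ht.1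
  opP_integrable x t _ s _ :=
    mainardiIntegrable_of_integrable D.half_lt D.le_one (D.integrable_sine _ x)
  duhamel_integrable Θ t ht := by
    rw [show duhamelIntegrand q C T ψ f (IccExtend hT.le Θ) t = _ from
      funext (D.duhamelIntegrand_eq f _ t)]
    refine D.intervalIntegrable_memoryKernel (F := fun s => f s (IccExtend hT.le Θ s)) ?_ ht
    exact hf.comp (f := fun s => (s, IccExtend hT.le Θ s))
      (continuousOn_id.prodMk (Θ.continuous.Icc_extend' (h := hT.le)).continuousOn)
      fun s hs => ⟨hs, mem_univ _⟩

end FormulaData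

end FracCosine

end

theorem theorem4p1 {X : Type*} [NormedAddCommGroup X] [NormedSpace ℝ X] [CompleteSpace X]
    (α : ℝ) (hα₁ : 1 < α) (hα₂ : α ≤ 2)
    (T : ℝ) (hT : 0 < T)
    (ψ : ℝ → ℝ) (hψ : ContDiffOn ℝ 1 ψ (Set.Icc 0 T)) (hψ_mono : StrictMonoOn ψ (Set.Icc 0 T))
    (hψ0 : FracCosine.dpsi T ψ 0 ≠ 0)
    (A : X →ₗ.[ℝ] X) (C : ℝ → X →L[ℝ] X)
    (hC : FracCosine.IsCosineFamily C) (_hA : FracCosine.IsCosineGenerator C A)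
    (K : ℝ) (hK : 1 ≤ K) (hCK : ∀ t : ℝ, ‖C t‖ ≤ K)
    (Θ₀ Θ₁ : X)
    (f : ℝ → X → X)
    (hf : ContinuousOn (Function.uncurry f) (Set.Icc 0 T ×ˢ Set.univ))
    (N₀ : ℝ) (hN₀ : 0 < N₀)
    (hf_lip : ∀ t ∈ Set.Icc 0 T, ∀ x y : X, ‖f t x - f t y‖ ≤ N₀ * ‖x - y‖)
    (q : ℝ) (hq : q = α / 2)
    (hH2 : K * N₀ * (ψ T - ψ 0) ^ (2 * q) / Real.Gamma (2 * q + 1) < 1) :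
    FracCosine.FormulaWellDefined q C hT ψ f ∧
    (∃! Θ : C(Set.Icc (0 : ℝ) T, X), FracCosine.IsMildSolution q C hT ψ f Θ₀ Θ₁ Θ) ∧
    ∃ Ψ : C(Set.Icc (0 : ℝ) T, X) → C(Set.Icc (0 : ℝ) T, X),
      (∀ (Θ : C(Set.Icc (0 : ℝ) T, X)) (t : Set.Icc (0 : ℝ) T),
        Ψ Θ t = FracCosine.mildRHS q C T ψ f Θ₀ Θ₁ (Set.IccExtend hT.le Θ) (t : ℝ)) ∧
      ContractingWith
        (Real.toNNReal (K * N₀ * (ψ T - ψ 0) ^ (2 * q) / Real.Gamma (2 * q + 1))) Ψ ∧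
      ∀ Θ : C(Set.Icc (0 : ℝ) T, X),
        FracCosine.IsMildSolution q C hT ψ f Θ₀ Θ₁ Θ ↔ Function.IsFixedPt Ψ Θ := by
  have D : FracCosine.FormulaData q T K ψ C :=
    ⟨by linarith, by linarith, hψ, hψ_mono, hC.strong_continuous, hCK, hT⟩
  have hwell := D.formulaWellDefined hT hf
  have hF : ∀ Θ : C(Set.Icc (0 : ℝ) T, X),
      ContinuousOn (fun s => f s (Set.IccExtend hT.le Θ s)) (Set.Icc 0 T) := fun Θ =>
    hf.comp (f := fun s => (s, Set.IccExtend hT.le Θ s))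
      (continuousOn_id.prodMk (Θ.continuous.Icc_extend' (h := hT.le)).continuousOn)
      fun s hs => ⟨hs, Set.mem_univ _⟩
  have hcont : ∀ Θ : C(Set.Icc (0 : ℝ) T, X), ContinuousOn
      (FracCosine.mildRHS q C T ψ f Θ₀ Θ₁ (Set.IccExtend hT.le Θ)) (Set.Icc 0 T) := fun Θ => by
    unfold FracCosine.mildRHS
    refine ((D.continuousOn_opC Θ₀).add (D.continuousOn_opR Θ₁)).add ?_
    simp only [D.duhamelIntegrand_eq]
    exact D.continuousOn_integral_memoryKernel (hF Θ)
  set L := K * N₀ * (ψ T - ψ 0) ^ (2 * q) / Real.Gamma (2 * q + 1) with hL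
  have hL0 : 0 ≤ L := by
    have hG := Real.Gamma_pos_of_pos (by linarith [D.half_lt] : 0 < 2 * q + 1)
    have hu := D.psi_sub_nonneg le_rfl hT.le le_rfl
    positivity
  let Ψ : C(Set.Icc (0 : ℝ) T, X) → C(Set.Icc (0 : ℝ) T, X) := fun Θ =>
    ⟨fun t => FracCosine.mildRHS q C T ψ f Θ₀ Θ₁ (Set.IccExtend hT.le Θ) t,
      continuousOn_iff_continuous_domRestrict.1 (hcont Θ)⟩
  have hΨ : ∀ (Θ : C(Set.Icc (0 : ℝ) T, X)) (t : Set.Icc (0 : ℝ) T),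
      Ψ Θ t = FracCosine.mildRHS q C T ψ f Θ₀ Θ₁ (Set.IccExtend hT.le Θ) (t : ℝ) :=
    fun _ _ => rfl
  have hfix : ∀ Θ : C(Set.Icc (0 : ℝ) T, X),
      FracCosine.IsMildSolution q C hT ψ f Θ₀ Θ₁ Θ ↔ Function.IsFixedPt Ψ Θ := fun Θ =>
    ⟨fun h => ContinuousMap.ext fun t => (h t).symm, fun h t => (DFunLike.congr_fun h t).symm⟩
  have hcontr : ContractingWith L.toNNReal Ψ := by
    refine ⟨by rwa [← Real.toNNReal_one, Real.toNNReal_lt_toNNReal_iff one_pos], ?_⟩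
    refine LipschitzWith.of_dist_le_mul fun Θ Θ' => ?_
    rw [Real.coe_toNNReal _ hL0, ContinuousMap.dist_le (by positivity)]
    intro t
    rw [dist_eq_norm, dist_eq_norm, hΨ, hΨ, FracCosine.mildRHS, FracCosine.mildRHS,
      add_sub_add_left_eq_sub]
    simp only [D.duhamelIntegrand_eq]
    rw [← intervalIntegral.integral_sub (D.intervalIntegrable_memoryKernel (hF Θ) t.2)
      (D.intervalIntegrable_memoryKernel (hF Θ') t.2)]
    simp only [← D.memoryKernel_sub]
    refine (D.norm_integral_memoryKernel_le (B := N₀ * ‖Θ - Θ'‖) (F := fun s =>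
      f s (Set.IccExtend hT.le Θ s) - f s (Set.IccExtend hT.le Θ' s)) t.2 ?_).trans (le_of_eq ?_)
    · intro s hs
      refine (hf_lip s hs _ _).trans ?_
      gcongr
      exact (Θ - Θ').norm_coe_le_norm _
    · rw [hL]; ring
  refine ⟨hwell, ?_, Ψ, hΨ, hcontr, hfix⟩
  refine ⟨ContractingWith.fixedPoint Ψ hcontr, (hfix _).2 hcontr.fixedPoint_isFixedPt, ?_⟩
  intro Θ hΘ
  exact hcontr.fixedPoint_unique ((hfix Θ).1 hΘ)
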